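/- Let $N\ge 1$, let $\zeta_0,\dots,\zeta_{N+1}$ and $M$ be real numbers, and let $1\le l\le N$. Put $x_0=0$, $x_{N+1}=M$, $(y)_n=y(y+1)\cdots(y+n-1)$, and, for $n=(n_1,\dots,n_N)\in\mathbb N^N$, $\mathbf N_k=n_1+\dots+n_k$. **Tridiagonal algebra.** $T(\beta,\gamma,\gamma^*,\rho,\rho^*)$ is the unital associative $\mathbb R$-algebra generated by $A,A^*$ with relations $$[A,\,A^2A^*-\beta AA^*A+A^*A^2-\gamma(AA^*+A^*A)-\rho A^*]=0,$$ $$[A^*,\,A^{*2}A-\beta A^*AA^*+AA^{*2}-\gamma^*(A^*A+AA^*)-\rho^* A]=0.$$ **Operators.** Let $\mathcal D'_x=\mathbb R(x_1,\dots,x_N)[E_{x_1}^{\pm1},\dots,E_{x_N}^{\pm1}]$ be the algebra of difference operators with rational coefficients acting on $\mathbb R(x_1,\dots,x_N)$, where $E_{x_i}$ is the shift $x_i\mapsto x_i+1$. Let $$\lambda^{(l)}_x=-(1+\zeta_{N+1-l})x_{N+1-l}-x_{N+1-l}(x_{N+1-l}-1)=-x_{N+1-l}(x_{N+1-l}+\zeta_{N+1-l}).$$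 Let $I_i$ be the involution $x_i\mapsto -x_i-\zeta_i$, and put $$B_i^{0,0}=x_i(x_i+\zeta_i)+x_{i+1}(x_{i+1}+\zeta_{i+1})+\tfrac12(\zeta_i+1)(\zeta_{i+1}-1),$$ $$B_i^{0,1}=(x_{i+1}+x_i+\zeta_{i+1})(x_{i+1}-x_i+\zeta_{i+1}-\zeta_i),\qquad B_i^{1,0}=(x_{i+1}-x_i)(x_{i+1}+x_i+\zeta_{i+1}),$$ $$B_i^{1,1}=(x_{i+1}+x_i+\zeta_{i+1})(x_{i+1}+x_i+\zeta_{i+1}+1),$$ $$b_i^0=(2x_i+\zeta_i+1)(2x_i+\zeta_i-1),\qquad b_i^1=(2x_i+\zeta_i+1)(2x_i+\zeta_i),$$ where an upper index $-1$ belonging to the variable $x_i$ is obtained from the upper index $1$ by applying $I_i$. The $l$-th Geronimo–Iliev Racah difference operator is $$\mathfrak L^x_l=\sum_{\nu\in\{-1,0,1\}^l}C_\nu\,E_{x_1}^{\nu_1}\cdots E_{x_l}^{\nu_l}-x_{l+1}(x_{l+1}+\zeta_{l+1})-\tfrac12(\zeta_0+1)(\zeta_{l+1}-1),$$ $$C_\nu=2^{\#\{i:\nu_i=0\}}\,\frac{\prod_{k=0}^{l}B_k^{\nu_k,\nu_{k+1}}}{\prod_{k=1}^{l}b_k^{\nu_k}},\qquad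 \nu_0=\nu_{l+1}=0 .$$ **Polynomials.** Let $$r_n(x;a,b,c,d)=(a+1)_n(b+d+1)_n(c+1)_n\;{}_4F_3\!\left[{-n,\ n+a+b+1,\ -x,\ x+c+d+1\atop a+1,\ b+d+1,\ c+1};1\right]$$ (the prefactor being multiplied into the terminating sum by $(y)_n/(y)_k=(y+k)_{n-k}$), and let $$R_N(n;x)=\prod_{k=1}^N r_{n_k}\big(-\mathbf N_{k-1}+x_k;\ 2\mathbf N_{k-1}+\zeta_k-\zeta_0-1,\ \zeta_{k+1}-\zeta_k-1,\ \mathbf N_{k-1}-x_{k+1}-1,\ \mathbf N_{k-1}+\zeta_k+x_{k+1}\big),$$ $$\widehat R_N(n;x)=\frac{R_N(n;x)}{(-M)_{\mathbf N_N}(-M-\zeta_0)_{\mathbf N_N}\prod_{k=1}^N(\zeta_{k+1}-\zeta_k)_{n_k}} .$$ Let $V=\mathbb R[x_1(x_1+\zeta_1),\dots,x_N(x_N+\zeta_N)]\subset\mathbb R(x_1,\dots,x_N)$. **Theorem.** Let $\rho=\zeta_{N+1-l}^2-1$ and $\rho^*=(\zeta_0-\zeta_{l+1}+1)^2-1$.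 1. $A\mapsto\lambda^{(l)}_x$, $A^*\mapsto\mathfrak L^x_l$ defines an algebra homomorphism $T(2,-2,-2,\rho,\rho^*)\to\mathcal D'_x$. 2. Both operators map $V$ into itself, so that $V$ becomes a module over $T(2,-2,-2,\rho,\rho^*)$ on which $A$ acts as multiplication by $\lambda^{(l)}_x$ and $A^*$ acts as $\mathfrak L^x_l$. 3. If none of $M$, $M+\zeta_0$ is a nonnegative integer and none of $\zeta_{k+1}-\zeta_k$, $\zeta_{k+1}-\zeta_0$ ($1\le k\le N$) is a nonpositive integer, then the normalized multivariable Racah polynomials $\widehat R_N(n;x)$, $n\in\mathbb N^N$, form a basis of the vector space $V$. -/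

import Mathlib

namespace RacahTD

open Finset

/-! ### Tridiagonal algebras -/

section TDAlgebra

variable (K : Type) [Field K]

/-- The defining relations of the tridiagonal algebra `T(β, γ, γ', ρ, ρ')`, imposed on the free
unital algebra on two letters: letter `0` is the generator `A`, letter `1` the generator `A*`. -/
inductive TDRel (β γ γ' ρ ρ' : K) : FreeAlgebra K (Fin 2) → FreeAlgebra K (Fin 2) → Prop
  | rel1 : TDRel β γ γ' ρ ρ'
      (let a := FreeAlgebra.ι K (0 : Fin 2)
       let b := FreeAlgebra.ι K (1 : Fin 2)
       ⁅a, a ^ 2 * b - β • (a * b * a) + b * a ^ 2 - γ • (a * b + b * a) - ρ • b⁆) 0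
  | rel2 : TDRel β γ γ' ρ ρ'
      (let a := FreeAlgebra.ι K (0 : Fin 2)
       let b := FreeAlgebra.ι K (1 : Fin 2)
       ⁅b, b ^ 2 * a - β • (b * a * b) + a * b ^ 2 - γ' • (b * a + a * b) - ρ' • a⁆) 0

/-- The tridiagonal algebra `T(β, γ, γ', ρ, ρ')` over `K`, by generators and relations. -/
abbrev TDAlg (β γ γ' ρ ρ' : K) : Type := RingQuot (TDRel K β γ γ' ρ ρ')

variable {K}

/-- The standard generator `A`. -/
def genA (β γ γ' ρ ρ' : K) : TDAlg K β γ γ' ρ ρ' :=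
  RingQuot.mkAlgHom K (TDRel K β γ γ' ρ ρ') (FreeAlgebra.ι K 0)

/-- The standard generator `A*`. -/
def genAstar (β γ γ' ρ ρ' : K) : TDAlg K β γ γ' ρ ρ' :=
  RingQuot.mkAlgHom K (TDRel K β γ γ' ρ ρ') (FreeAlgebra.ι K 1)

end TDAlgebra

/-! ### Difference operators with rational coefficients -/

/-- The field `ℝ(x_1, …, x_N)`. -/
abbrev RatField (N : ℕ) : Type := FractionRing (MvPolynomial (Fin N) ℝ)

noncomputable section

/-- The translation `x_i ↦ x_i + ν_i` of the polynomial ring `ℝ[x_1, …, x_N]`. -/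
def polyShift {N : ℕ} (ν : Fin N → ℤ) :
    MvPolynomial (Fin N) ℝ ≃ₐ[ℝ] MvPolynomial (Fin N) ℝ :=
  AlgEquiv.ofAlgHom
    (MvPolynomial.aeval fun i => MvPolynomial.X i + MvPolynomial.C (ν i : ℝ))
    (MvPolynomial.aeval fun i => MvPolynomial.X i - MvPolynomial.C (ν i : ℝ))
    (by ext i; simp)
    (by ext i; simp)

/-- The shift `E^ν = ∏ E_{x_i}^{ν_i}` on rational functions, `(E^ν f)(x) = f(x + ν)`. -/
def shift {N : ℕ} (ν : Fin N → ℤ) : RatField N ≃ₐ[ℝ] RatField N :=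
  IsFractionRing.algEquivOfAlgEquiv (polyShift ν)

/-- The algebra `ℝ(x_1, …, x_N)[E_{x_1}^{±1}, …, E_{x_N}^{±1}]` of difference operators, as the
algebra of operators on `ℝ(x_1, …, x_N)` generated by all multiplications and all unit shifts. -/
def diffOps (N : ℕ) : Subalgebra ℝ (Module.End ℝ (RatField N)) :=
  Algebra.adjoin ℝ
    (Set.range (fun f : RatField N => LinearMap.mulLeft ℝ f) ∪
      Set.range (fun i : Fin N => (shift (Pi.single i 1)).toLinearMap) ∪
      Set.range (fun i : Fin N => (shift (Pi.single i (-1))).toLinearMap))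

/-- A real number as a constant rational function. -/
abbrev cst (N : ℕ) (r : ℝ) : RatField N := algebraMap ℝ (RatField N) r

/-- `x_k` for `k = 0, …, N + 1`, with the conventions `x_0 = 0` and `x_{N+1} = M`. -/
def xv (N : ℕ) (M : ℝ) (k : ℕ) : RatField N :=
  if h : 1 ≤ k ∧ k ≤ N then
    algebraMap (MvPolynomial (Fin N) ℝ) (RatField N) (MvPolynomial.X ⟨k - 1, by omega⟩)
  else if k = 0 then 0 else cst N M

/-! ### Racah polynomials -/

/-- The shifted factorial `(y)_n = y (y + 1) ⋯ (y + n - 1)`. -/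
def poch {K : Type} [Field K] (y : K) (n : ℕ) : K := (ascPochhammer K n).eval y

/-- The one-variable Racah polynomial `r_n(x; a, b, c, d)`. The prefactor
`(a+1)_n (b+d+1)_n (c+1)_n` has been multiplied into the terminating hypergeometric sum by
`(y)_n / (y)_k = (y+k)_{n-k}`; see `racah1_eq`. -/
def racah1 {K : Type} [Field K] (n : ℕ) (x a b c d : K) : K :=
  ∑ k ∈ range (n + 1),
    poch (-(n : K)) k * poch (n + a + b + 1) k * poch (-x) k * poch (x + c + d + 1) k
      / (k.factorial : K)
      * (poch (a + 1 + k) (n - k) * poch (b + d + 1 + k) (n - k) * poch (c + 1 + k) (n - k))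

theorem poch_split {K : Type} [Field K] (y : K) {n k : ℕ} (h : k ≤ n) :
    poch y n = poch y k * poch (y + k) (n - k) := by
  obtain ⟨m, rfl⟩ := Nat.exists_eq_add_of_le h
  simp only [poch, ← ascPochhammer_mul, Polynomial.eval_mul, Polynomial.eval_comp,
    Polynomial.eval_add, Polynomial.eval_X, Polynomial.eval_natCast, Nat.add_sub_cancel_left]

/-- Where its denominators do not vanish, `r_n` is the prefactor times the `₄F₃` at `1`. -/
theorem racah1_eq {K : Type} [Field K] (n : ℕ) (x a b c d : K)
    (ha : poch (a + 1) n ≠ 0) (hb : poch (b + d + 1) n ≠ 0) (hc : poch (c + 1) n ≠ 0) :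
    racah1 n x a b c d =
      poch (a + 1) n * poch (b + d + 1) n * poch (c + 1) n *
        ∑ k ∈ range (n + 1),
          poch (-(n : K)) k * poch (n + a + b + 1) k * poch (-x) k * poch (x + c + d + 1) k
            / (poch (a + 1) k * poch (b + d + 1) k * poch (c + 1) k * (k.factorial : K)) := by
  rw [racah1, mul_sum]
  refine sum_congr rfl fun k hk => ?_
  have h : k ≤ n := by simpa [Nat.lt_succ_iff] using hk
  rw [poch_split _ h] at ha hb hc ⊢
  rw [poch_split (b + d + 1) h, poch_split (c + 1) h]
  have ha' := left_ne_zero_of_mul ha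
  have hb' := left_ne_zero_of_mul hb
  have hc' := left_ne_zero_of_mul hc
  by_cases hf : (k.factorial : K) = 0
  · simp [hf]
  · field_simp

/-- The `k`-th entry `n_k` (`k = 1, …, N`) of a multi-index. -/
def idx {N : ℕ} (n : Fin N → ℕ) (k : ℕ) : ℕ :=
  if h : 1 ≤ k ∧ k ≤ N then n ⟨k - 1, by omega⟩ else 0

/-- The partial sum `n_1 + ⋯ + n_k`. -/
def psum {N : ℕ} (n : Fin N → ℕ) (k : ℕ) : ℕ := ∑ j ∈ Icc 1 k, idx n j

/-- Tratnik's multivariable Racah polynomial `R_N({n}, {x}, {ζ}, M)`. -/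
def racahR (N : ℕ) (ζ : ℕ → ℝ) (M : ℝ) (n : Fin N → ℕ) : RatField N :=
  ∏ k ∈ Icc 1 N,
    racah1 (idx n k)
      (-(psum n (k - 1) : RatField N) + xv N M k)
      (2 * (psum n (k - 1) : RatField N) + cst N (ζ k - ζ 0 - 1))
      (cst N (ζ (k + 1) - ζ k - 1))
      ((psum n (k - 1) : RatField N) - xv N M (k + 1) - 1)
      ((psum n (k - 1) : RatField N) + cst N (ζ k) + xv N M (k + 1))

/-- The normalizing denominator of the multivariable Racah polynomial. -/
def racahNorm (N : ℕ) (ζ : ℕ → ℝ) (M : ℝ) (n : Fin N → ℕ) : ℝ :=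
  poch (-M) (psum n N) * poch (-M - ζ 0) (psum n N) *
    ∏ k ∈ Icc 1 N, poch (ζ (k + 1) - ζ k) (idx n k)

/-- The normalized multivariable Racah polynomial. -/
def racahHat (N : ℕ) (ζ : ℕ → ℝ) (M : ℝ) (n : Fin N → ℕ) : RatField N :=
  racahR N ζ M n / cst N (racahNorm N ζ M n)

/-- The space of polynomials in the `N` variables `x_1(x_1+ζ_1), …, x_N(x_N+ζ_N)`. -/
def polySpace (N : ℕ) (ζ : ℕ → ℝ) : Subalgebra ℝ (RatField N) :=
  Algebra.adjoin ℝ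
    (Set.range fun i : Fin N =>
      xv N 0 (i + 1) * (xv N 0 (i + 1) + cst N (ζ (i + 1))))

/-! ### The Geronimo–Iliev Racah difference operators -/

/-- The involution `I : x ↦ -x - ζ`, applied if the index is `-1`. -/
def invol {K : Type} [Field K] (s : SignType) (z u : K) : K :=
  match s with
  | .neg => -u - z
  | .zero => u
  | .pos => u

/-- The factor `B^{s,t}` for neighbouring variables `u = x_i`, `v = x_{i+1}` with parameters
`z = ζ_i`, `w = ζ_{i+1}`; an index `-1` is obtained from `1` by the involution in that variable. -/
def Bfac {K : Type} [Field K] (s t : SignType) (z w u v : K) : K :=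
  let u' := invol s z u
  let v' := invol t w v
  if s = 0 then
    if t = 0 then u' * (u' + z) + v' * (v' + w) + (z + 1) * (w - 1) / 2
    else (v' + u' + w) * (v' - u' + w - z)
  else
    if t = 0 then (v' - u') * (v' + u' + w)
    else (v' + u' + w) * (v' + u' + w + 1)

/-- The factor `b^s` for the variable `u = x_i` with parameter `z = ζ_i`. -/
def bfac {K : Type} [Field K] (s : SignType) (z u : K) : K :=
  let u' := invol s z u
  if s = 0 then (2 * u' + z + 1) * (2 * u' + z - 1) else (2 * u' + z + 1) * (2 * u' + z)

/-- `ν_k` for a vector `ν ∈ {-1,0,1}^l`, extended by zero outside `1 ≤ k ≤ l`. -/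
def ext0 {l : ℕ} (ν : Fin l → SignType) (k : ℕ) : SignType :=
  if h : 1 ≤ k ∧ k ≤ l then ν ⟨k - 1, by omega⟩ else 0

/-- The coefficient `C_ν = 2^{#{i : ν_i = 0}} ∏_{k=0}^l B_k^{ν_k,ν_{k+1}} / ∏_{k=1}^l b_k^{ν_k}`. -/
def Ccoef (N : ℕ) (ζ : ℕ → ℝ) (M : ℝ) (l : ℕ) (ν : Fin l → SignType) : RatField N :=
  2 ^ (univ.filter fun i => ν i = 0).card *
    (∏ k ∈ range (l + 1), Bfac (ext0 ν k) (ext0 ν (k + 1))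
      (cst N (ζ k)) (cst N (ζ (k + 1))) (xv N M k) (xv N M (k + 1))) /
    ∏ k ∈ Icc 1 l, bfac (ext0 ν k) (cst N (ζ k)) (xv N M k)

/-- The `l`-th Racah difference operator
`∑_{ν ∈ {-1,0,1}^l} C_ν E^ν - (x_{l+1}(x_{l+1} + ζ_{l+1}) + (ζ_0 + 1)(ζ_{l+1} - 1)/2)`
on `ℝ(x_1, …, x_N)`. It shifts `x_1, …, x_l`, while `x_{l+1}` enters as a parameter
(and is `M` for `l = N`). -/
def racahOp (N : ℕ) (ζ : ℕ → ℝ) (M : ℝ) (l : ℕ) : Module.End ℝ (RatField N) :=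
  (∑ ν : Fin l → SignType,
    LinearMap.mulLeft ℝ (Ccoef N ζ M l ν) *
      (shift fun i : Fin N => ((ext0 ν (i + 1) : SignType) : ℤ)).toLinearMap) -
    LinearMap.mulLeft ℝ
      (xv N M (l + 1) * (xv N M (l + 1) + cst N (ζ (l + 1))) +
        cst N ((ζ 0 + 1) * (ζ (l + 1) - 1) / 2))

/-- The spectrum function
`λ_x^{(l)} = -(1 + ζ_{N+1-l}) x_{N+1-l} - x_{N+1-l} (x_{N+1-l} - 1)`. -/
def lamX (N : ℕ) (ζ : ℕ → ℝ) (M : ℝ) (l : ℕ) : RatField N :=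
  -(cst N (1 + ζ (N + 1 - l)) * xv N M (N + 1 - l)) -
    xv N M (N + 1 - l) * (xv N M (N + 1 - l) - 1)

/-- The tridiagonal algebra `T(2, -2, -2, ζ_{N+1-l}² - 1, (ζ_0 - ζ_{l+1} + 1)² - 1)` over `ℝ`. -/
abbrev RacahTDAlg (N : ℕ) (ζ : ℕ → ℝ) (l : ℕ) : Type :=
  TDAlg ℝ 2 (-2) (-2) (ζ (N + 1 - l) ^ 2 - 1) ((ζ 0 - ζ (l + 1) + 1) ^ 2 - 1)

/-- Its generator `A`. -/
abbrev racahA (N : ℕ) (ζ : ℕ → ℝ) (l : ℕ) : RacahTDAlg N ζ l :=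
  genA 2 (-2) (-2) (ζ (N + 1 - l) ^ 2 - 1) ((ζ 0 - ζ (l + 1) + 1) ^ 2 - 1)

/-- Its generator `A*`. -/
abbrev racahAstar (N : ℕ) (ζ : ℕ → ℝ) (l : ℕ) : RacahTDAlg N ζ l :=
  genAstar 2 (-2) (-2) (ζ (N + 1 - l) ^ 2 - 1) ((ζ 0 - ζ (l + 1) + 1) ^ 2 - 1)

end

end RacahTD

/-! In the symmetric variables y_k = x_k + ζ_k/2 the involutions become sign changes and the
coefficients C_ν factor along a chain of sites: a two-site `coupling` for neighbouring states in
{-1,0,1} and a one-site `weight`. The Racah operator, up to its potential, is therefore a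
transfer-matrix sum, built site by site as `row i s`, the sum over the states of the sites 1, …, i
with the state s of site i+1 prescribed.

The rows at a site give three operators: U = `row i 1` followed by the shift of y_{i+1}, D = `row i
(-1)` followed by the inverse shift, and C = `row i 0` - y_{i+1}². They satisfy the relations of a
generalized Weyl algebra in which H = 4 y_0² is the only parameter. `IsRacahTriple.transfer` carries
these relations from one site to the next, by two identities of rational functions (`transfer_comm`,
`transfer_mul`).

Second tridiagonal relation: λ is, up to sign and a constant, the square of one variable y =
y_{N+1-l}. If this variable is not shifted, λ commutes with the operator. Otherwise the chain is cut
at that site. Couplings are symmetric up to a sign, so the right part, read backwards, is again a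
chain, and `row_split` writes the full sum L through the two triples meeting at y. Their elements C
and C' commute with L, and `IsRacahQuadruple.tridiagonal` evaluates L²X - 2LXL + XL² + 2(LX + XL) -
κX, X = y², as a polynomial in L, C, C' with coefficients fixed by the shift of y. So it commutes
with L. The potential is absorbed in κ, which determines ρ*.

First relation: a term of the operator moves y by 0 or ±1, and in each case one factor of the cubic
commutator expression in λ vanishes.

Polynomials: the operator has poles at y = 0, ±1/2, which cancel on functions even in each y_k;
`row_mem` carries a statement about all three rows through the induction.

Basis: each factor of a Racah polynomial is a polynomial in two consecutive generators x_k(x_k+ζ_k),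
with lexicographic leading exponent n_k at the k-th one. The normalized polynomials thus have every
exponent n exactly once as leading exponent and are triangular with respect to the monomials. -/

section RacahTriple

/-! ### Generalized Weyl algebra relations and the two transfer identities. -/

variable {F A : Type*} [Field F] [CharZero F] [Ring A] [Module F A] [IsScalarTower F A A]

/-- Elements `U, D, C` of a ring acted on by a field `F` that satisfy the relations of a
generalized Weyl algebra over `F[C]`: `C` is central, `U` and `D` shift `y` by `1` and `-1`, and the
products `U D`, `D U` are the values of `(y² + y + 1/2 + C)² - H (y + 1/2)²` at `y` and `-y`. -/
structure IsRacahTriple (σ σ' : F →+* F) (y H : F) (U D C : A) : Prop where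
  U_smul : ∀ (f : F) (x : A), U * (f • x) = σ f • (U * x)
  D_smul : ∀ (f : F) (x : A), D * (f • x) = σ' f • (D * x)
  C_smul : ∀ (f : F) (x : A), C * (f • x) = f • (C * x)
  UC : U * C = C * U
  DC : D * C = C * D
  UD : U * D = C * C + (2 * (y ^ 2 + y + 1 / 2)) • C
    + ((y ^ 2 + y + 1 / 2) ^ 2 - H * (y + 1 / 2) ^ 2) • (1 : A)
  DU : D * U = C * C + (2 * (y ^ 2 - y + 1 / 2)) • C
    + ((y ^ 2 - y + 1 / 2) ^ 2 - H * (y - 1 / 2) ^ 2) • (1 : A)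

/-- The general element of degree at most one in `U`, `C`, `D`. -/
def tripleComb (p q r s : F) (U D C : A) : A := p • U + q • C + r • D + s • (1 : A)

/-- One step of the transfer, with upper index `0` for the new variable `v`. -/
def transferZero (d y v : F) (U D C : A) : A :=
  tripleComb ((v ^ 2 - (y + d / 2) ^ 2) / ((2 * y + 1) * (2 * y)))
    (2 * (y ^ 2 + v ^ 2 - d ^ 2 / 4 + d / 2 - 1 / 2) / ((2 * y + 1) * (2 * y - 1)))
    ((v ^ 2 - (y - d / 2) ^ 2) / ((2 * y - 1) * (2 * y)))
    (2 * (y ^ 2 + v ^ 2 - d ^ 2 / 4 + d / 2 - 1 / 2) / ((2 * y + 1) * (2 * y - 1)) * y ^ 2) U D C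

/-- One step of the transfer, with upper index `1` for the new variable `v`. -/
def transferOne (d y v : F) (U D C : A) : A :=
  tripleComb ((v + y + d / 2) * (v + y + d / 2 + 1) / ((2 * y + 1) * (2 * y)))
    (2 * ((v + d / 2) ^ 2 - y ^ 2) / ((2 * y + 1) * (2 * y - 1)))
    ((v - y + d / 2) * (v - y + d / 2 + 1) / ((2 * y - 1) * (2 * y)))
    (2 * ((v + d / 2) ^ 2 - y ^ 2) / ((2 * y + 1) * (2 * y - 1)) * y ^ 2) U D C

namespace IsRacahTriple

variable {σ σ' : F →+* F} {y H : F} {U D C : A}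

/-- Normal ordering: scalars on the left, C before U and D, and the products UD and DU eliminated.
Identities between products of combinations can then be checked coefficient by coefficient. -/
theorem tripleComb_mul (h : IsRacahTriple σ σ' y H U D C) (p q r s p' q' r' s' : F) :
    tripleComb p q r s U D C * tripleComb p' q' r' s' U D C =
      (p * σ p') • (U * U) + (r * σ' r') • (D * D) +
      (p * σ q' + q * p') • (C * U) + (p * σ s' + s * p') • U +
      (r * σ' q' + q * r') • (C * D) + (r * σ' s' + s * r') • D +
      (q * q' + p * σ r' + r * σ' p') • (C * C) +
      (q * s' + s * q' + p * σ r' * (2 * (y ^ 2 + y + 1 / 2)) +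
        r * σ' p' * (2 * (y ^ 2 - y + 1 / 2))) • C +
      (s * s' + p * σ r' * ((y ^ 2 + y + 1 / 2) ^ 2 - H * (y + 1 / 2) ^ 2) +
        r * σ' p' * ((y ^ 2 - y + 1 / 2) ^ 2 - H * (y - 1 / 2) ^ 2)) • (1 : A) := by
  simp only [tripleComb, mul_add (R := A), add_mul (R := A),
    smul_mul_assoc, h.U_smul, h.D_smul, h.C_smul, h.UC, h.DC, h.UD, h.DU, mul_one, one_mul]
  module

set_option maxRecDepth 4000 in
set_option maxHeartbeats 800000 in
-- Write Z(v), T(v) for the two transfers. If T(v) is followed by the shift v ↦ v + 1, this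
-- intertwining says that the new raising element commutes with Z(v) - v², the new C. After normal
-- ordering only identities of rational functions in y, v, d, H remain.
theorem transfer_comm (h : IsRacahTriple σ σ' y H U D C) (hy : ∀ n : ℤ, 2 * y + n ≠ 0)
    {d v : F} (hσy : σ y = y + 1) (hσy' : σ' y = y - 1)
    (hσv : σ v = v) (hσv' : σ' v = v) (hσd : σ d = d) (hσd' : σ' d = d) :
    (transferZero d y v U D C - v ^ 2 • (1 : A)) * transferOne d y v U D C =
      transferOne d y v U D C *
        (transferZero d y (v + 1) U D C - (v + 1) ^ 2 • (1 : A)) := by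
  -- The denominators of the coefficients are 2y and 2y ± 1; σ and σ' move them by ±2, so 2y + n
  -- with |n| ≤ 3 covers everything.
  have h0 : y ≠ 0 := fun e => hy 0 (by simp [e])
  have h1 : 2 * y + 1 ≠ 0 := by simpa using hy 1
  have h2 : 2 * y - 1 ≠ 0 := by simpa [sub_eq_add_neg] using hy (-1)
  have h3 : y + 1 ≠ 0 := fun e => hy 2 (by push_cast; linear_combination 2 * e)
  have h4 : y - 1 ≠ 0 := fun e => hy (-2) (by push_cast; linear_combination 2 * e)
  have h5 : 2 * y + 3 ≠ 0 := by simpa using hy 3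
  have h6 : 2 * y - 3 ≠ 0 := by simpa [sub_eq_add_neg] using hy (-3)
  have h1' : y * 2 + 1 ≠ 0 := by rwa [mul_comm]
  have h2' : y * 2 - 1 ≠ 0 := by rwa [mul_comm]
  have h5' : y * 2 + 3 ≠ 0 := by rwa [mul_comm]
  have h6' : y * 2 - 3 ≠ 0 := by rwa [mul_comm]
  have e1 : 2 * (y + 1) + 1 = 2 * y + 3 := by ring
  have e2 : 2 * (y + 1) - 1 = 2 * y + 1 := by ring
  have e3 : 2 * (y - 1) + 1 = 2 * y - 1 := by ring
  have e4 : 2 * (y - 1) - 1 = 2 * y - 3 := by ring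
  have e (p q r s t : F) : tripleComb p q r s U D C - t • (1 : A) =
    tripleComb p q r (s - t) U D C := by simp only [tripleComb]; module
  simp only [transferZero, transferOne, e, h.tripleComb_mul,
    map_add, map_mul, map_div₀, map_pow, map_sub, map_one, map_ofNat,
    hσy, hσy', hσv, hσv', hσd, hσd', e1, e2, e3, e4]
  match_scalars <;> (simp only [mul_one]; field_simp; ring)

set_option maxRecDepth 4000 in
set_option maxHeartbeats 800000 in
-- The argument -v - 1 is what -v becomes under the shift of v, so the left side is the product of
-- the new raising and lowering elements. On the right Z(v) + v + 1/2 is C + v² + v + 1/2 for the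
-- new C: the relation reproduces itself with the same H.
theorem transfer_mul (h : IsRacahTriple σ σ' y H U D C) (hy : ∀ n : ℤ, 2 * y + n ≠ 0)
    {d v : F} (hσy : σ y = y + 1) (hσy' : σ' y = y - 1)
    (hσv : σ v = v) (hσv' : σ' v = v) (hσd : σ d = d) (hσd' : σ' d = d) :
    transferOne d y v U D C * transferOne d y (-v - 1) U D C =
      (transferZero d y v U D C + (v + 1 / 2) • (1 : A)) *
        (transferZero d y v U D C + (v + 1 / 2) • (1 : A)) -
        (H * (v + 1 / 2) ^ 2) • (1 : A) := by
  have h0 : y ≠ 0 := fun e => hy 0 (by simp [e])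
  have h1 : 2 * y + 1 ≠ 0 := by simpa using hy 1
  have h2 : 2 * y - 1 ≠ 0 := by simpa [sub_eq_add_neg] using hy (-1)
  have h3 : y + 1 ≠ 0 := fun e => hy 2 (by push_cast; linear_combination 2 * e)
  have h4 : y - 1 ≠ 0 := fun e => hy (-2) (by push_cast; linear_combination 2 * e)
  have h5 : 2 * y + 3 ≠ 0 := by simpa using hy 3
  have h6 : 2 * y - 3 ≠ 0 := by simpa [sub_eq_add_neg] using hy (-3)
  have h1' : y * 2 + 1 ≠ 0 := by rwa [mul_comm]
  have h2' : y * 2 - 1 ≠ 0 := by rwa [mul_comm]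
  have h5' : y * 2 + 3 ≠ 0 := by rwa [mul_comm]
  have h6' : y * 2 - 3 ≠ 0 := by rwa [mul_comm]
  have e1 : 2 * (y + 1) + 1 = 2 * y + 3 := by ring
  have e2 : 2 * (y + 1) - 1 = 2 * y + 1 := by ring
  have e3 : 2 * (y - 1) + 1 = 2 * y - 1 := by ring
  have e4 : 2 * (y - 1) - 1 = 2 * y - 3 := by ring
  have e (p q r s t : F) : tripleComb p q r s U D C + t • (1 : A) =
    tripleComb p q r (s + t) U D C := by simp only [tripleComb]; module
  rw [eq_sub_iff_add_eq]
  simp only [transferZero, transferOne, e, h.tripleComb_mul,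
    map_add, map_mul, map_div₀, map_pow, map_sub, map_neg, map_one, map_ofNat,
    hσy, hσy', hσv, hσv', hσd, hσd', e1, e2, e3, e4]
  match_scalars <;> (simp only [mul_one]; field_simp; ring)

end IsRacahTriple
end RacahTriple

/-! ### Two triples sharing one variable, and the cubic relation for their combination. -/

section RacahQuadruple

variable {F A : Type*} [Field F] [CharZero F] [Ring A] [Module F A] [IsScalarTower F A A]

/-- The product of the values of `(y² + y + 1/2 + C)² - H (y + 1/2)²` at two commuting elements. -/
def weylProd (y H H' : F) (C C' : A) : A :=
  (C * C + (2 * (y ^ 2 + y + 1 / 2)) • C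
    + ((y ^ 2 + y + 1 / 2) ^ 2 - H * (y + 1 / 2) ^ 2) • (1 : A)) *
  (C' * C' + (2 * (y ^ 2 + y + 1 / 2)) • C'
    + ((y ^ 2 + y + 1 / 2) ^ 2 - H' * (y + 1 / 2) ^ 2) • (1 : A))

/-- Elements of a generalized Weyl algebra with two central elements `C`, `C'`. -/
structure IsRacahQuadruple (σ σ' : F →+* F) (y H H' : F) (U D C C' : A) : Prop where
  U_smul : ∀ (f : F) (x : A), U * (f • x) = σ f • (U * x)
  D_smul : ∀ (f : F) (x : A), D * (f • x) = σ' f • (D * x)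
  C_smul : ∀ (f : F) (x : A), C * (f • x) = f • (C * x)
  C'_smul : ∀ (f : F) (x : A), C' * (f • x) = f • (C' * x)
  UC : U * C = C * U
  DC : D * C = C * D
  UC' : U * C' = C' * U
  DC' : D * C' = C' * D
  CC' : C' * C = C * C'
  UD : U * D = weylProd y H H' C C'
  DU : D * U = weylProd (-y) H H' C C'

/-- A combination of `U`, `D` and of the monomials of bidegree at most one in `C`, `C'`. -/
def quadComb (p r q q₁ q₂ s : F) (U D C C' : A) : A :=
  p • U + r • D + q • (C * C') + q₁ • C + q₂ • C' + s • (1 : A)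

namespace IsRacahQuadruple

variable {σ σ' : F →+* F} {y H H' : F} {U D C C' : A}

set_option maxHeartbeats 1600000 in
theorem quadComb_mul (h : IsRacahQuadruple σ σ' y H H' U D C C')
    (p r q q₁ q₂ s p' r' q' q₁' q₂' s' : F) :
    quadComb p r q q₁ q₂ s U D C C' * quadComb p' r' q' q₁' q₂' s' U D C C' =
      (p * σ p') • (U * U) + (r * σ' r') • (D * D) +
      quadComb (p * σ q') (r * σ' q') 0 0 0 0 (C * (C' * U)) (C * (C' * D)) C C' +
      quadComb (p * σ q₁') (r * σ' q₁') 0 0 0 0 (C * U) (C * D) C C' +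
      quadComb (p * σ q₂') (r * σ' q₂') 0 0 0 0 (C' * U) (C' * D) C C' +
      quadComb (p * σ s') (r * σ' s') 0 0 0 0 U D C C' +
      (p * σ r') • weylProd y H H' C C' +
      (r * σ' p') • weylProd (-y) H H' C C' +
      quadComb (q * p') (q * r') 0 0 0 0 (C * (C' * U)) (C * (C' * D)) C C' +
      quadComb (q₁ * p') (q₁ * r') 0 0 0 0 (C * U) (C * D) C C' +
      quadComb (q₂ * p') (q₂ * r') 0 0 0 0 (C' * U) (C' * D) C C' +
      quadComb (s * p') (s * r') 0 0 0 0 U D C C' +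
      (q * q') • (C * (C * (C' * C'))) + (q * q₁' + q₁ * q') • (C * (C * C')) +
      (q * q₂' + q₂ * q') • (C * (C' * C')) + (q₁ * q₁') • (C * C) + (q₂ * q₂') • (C' * C') +
      quadComb 0 0 (q * s' + s * q' + q₁ * q₂' + q₂ * q₁') (q₁ * s' + s * q₁')
        (q₂ * s' + s * q₂') (s * s') U D C C' := by
  have a1 (x : A) : C' * (C * x) = C * (C' * x) := by rw [← mul_assoc, h.CC', mul_assoc]
  have a2 (x : A) : U * (C * x) = C * (U * x) := by rw [← mul_assoc, h.UC, mul_assoc]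
  have a3 (x : A) : D * (C * x) = C * (D * x) := by rw [← mul_assoc, h.DC, mul_assoc]
  simp only [quadComb, mul_add (R := A), add_mul (R := A),
    smul_mul_assoc, h.U_smul, h.D_smul, h.C_smul, h.C'_smul, mul_assoc, h.UC, h.DC, h.UC', h.DC',
    h.CC', a1, a2, a3, h.UD, h.DU, mul_one, one_mul]
  module

set_option maxRecDepth 4000 in
set_option maxHeartbeats 1600000 in
-- The coefficients of L are those of a chain cut at the variable y, see `row_eq_quadComb`. The left
-- side is grouped so that L y² - 2y² L, again a `quadComb`, is formed first; only products of two
-- combinations then have to be normal ordered.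
theorem tridiagonal (h : IsRacahQuadruple σ σ' y H H' U D C C') (hy : ∀ n : ℤ, 2 * y + n ≠ 0)
    (hσy : σ y = y + 1) (hσy' : σ' y = y - 1) (L : A)
    (hL : L = quadComb (-1 / ((2 * y + 1) * (2 * y))) (-1 / ((2 * y - 1) * (2 * y)))
      (2 / ((2 * y + 1) * (2 * y - 1))) (2 / ((2 * y + 1) * (2 * y - 1)) * y ^ 2)
      (2 / ((2 * y + 1) * (2 * y - 1)) * y ^ 2) (2 / ((2 * y + 1) * (2 * y - 1)) * y ^ 4) U D C C') :
    L * (L * y ^ 2 • 1 - (2 * y ^ 2) • L) + y ^ 2 • (L * L) + (2 : F) • (L * y ^ 2 • 1 + y ^ 2 • L) -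
      ((H + H' - 2) * y ^ 2) • (1 : A) =
    (2 : F) • (L * L) - (2 : F) • ((C + C') * L) +
      ((2 : F) • (C * C') - (1 / 2 : F) • (((1 - H) • 1 + (2 : F) • C) *
        ((1 - H') • 1 + (2 : F) • C'))) := by
  have h0 : y ≠ 0 := fun e => hy 0 (by simp [e])
  have h1 : 2 * y + 1 ≠ 0 := by simpa using hy 1
  have h2 : 2 * y - 1 ≠ 0 := by simpa [sub_eq_add_neg] using hy (-1)
  have h3 : y + 1 ≠ 0 := fun e => hy 2 (by push_cast; linear_combination 2 * e)
  have h4 : y - 1 ≠ 0 := fun e => hy (-2) (by push_cast; linear_combination 2 * e)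
  have h5 : 2 * y + 3 ≠ 0 := by simpa using hy 3
  have h6 : 2 * y - 3 ≠ 0 := by simpa [sub_eq_add_neg] using hy (-3)
  have h1' : y * 2 + 1 ≠ 0 := by rwa [mul_comm]
  have h2' : y * 2 - 1 ≠ 0 := by rwa [mul_comm]
  have h5' : y * 2 + 3 ≠ 0 := by rwa [mul_comm]
  have h6' : y * 2 - 3 ≠ 0 := by rwa [mul_comm]
  have e1 : 2 * (y + 1) + 1 = 2 * y + 3 := by ring
  have e2 : 2 * (y + 1) - 1 = 2 * y + 1 := by ring
  have e3 : 2 * (y - 1) + 1 = 2 * y - 1 := by ring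
  have e4 : 2 * (y - 1) - 1 = 2 * y - 3 := by ring
  have k1 (p r q q₁ q₂ s : F) : quadComb p r q q₁ q₂ s U D C C' * y ^ 2 • 1 =
      quadComb (p * (y + 1) ^ 2) (r * (y - 1) ^ 2) (q * y ^ 2) (q₁ * y ^ 2) (q₂ * y ^ 2) (s * y ^ 2)
        U D C C' := by
    simp only [quadComb, add_mul (R := A), smul_mul_assoc, h.U_smul, h.D_smul, h.C_smul, h.C'_smul,
      mul_assoc, mul_one, one_mul, map_pow, hσy, hσy']
    module
  have k2 (t p r q q₁ q₂ s : F) : t • quadComb p r q q₁ q₂ s U D C C' =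
      quadComb (t * p) (t * r) (t * q) (t * q₁) (t * q₂) (t * s) U D C C' := by
    simp only [quadComb]
    module
  have k3 (p r q q₁ q₂ s p' r' q' q₁' q₂' s' : F) : quadComb p r q q₁ q₂ s U D C C' -
      quadComb p' r' q' q₁' q₂' s' U D C C' =
      quadComb (p - p') (r - r') (q - q') (q₁ - q₁') (q₂ - q₂') (s - s') U D C C' := by
    simp only [quadComb]
    module
  have k4 (p r q q₁ q₂ s : F) : (C + C') * quadComb p r q q₁ q₂ s U D C C' =
      p • (C * U) + p • (C' * U) + r • (C * D) + r • (C' * D) + q • (C * (C * C')) +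
      q • (C * (C' * C')) + q₁ • (C * C) + (q₁ + q₂) • (C * C') + q₂ • (C' * C') +
      s • C + s • C' := by
    have a1 (x : A) : C' * (C * x) = C * (C' * x) := by rw [← mul_assoc, h.CC', mul_assoc]
    simp only [quadComb, mul_add (R := A), add_mul (R := A), h.C_smul, h.C'_smul,
      mul_one, a1, h.CC']
    module
  have a4 (y : F) : weylProd y H H' C C' = C * (C * (C' * C')) +
      (2 * (y ^ 2 + y + 1 / 2)) • (C * (C * C')) + (2 * (y ^ 2 + y + 1 / 2)) • (C * (C' * C')) +
      (4 * (y ^ 2 + y + 1 / 2) ^ 2) • (C * C') +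
      ((y ^ 2 + y + 1 / 2) ^ 2 - H * (y + 1 / 2) ^ 2) • (C' * C') +
      ((y ^ 2 + y + 1 / 2) ^ 2 - H' * (y + 1 / 2) ^ 2) • (C * C) +
      (((y ^ 2 + y + 1 / 2) ^ 2 - H * (y + 1 / 2) ^ 2) * (2 * (y ^ 2 + y + 1 / 2))) • C' +
      (((y ^ 2 + y + 1 / 2) ^ 2 - H' * (y + 1 / 2) ^ 2) * (2 * (y ^ 2 + y + 1 / 2))) • C +
      (((y ^ 2 + y + 1 / 2) ^ 2 - H * (y + 1 / 2) ^ 2) *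
        ((y ^ 2 + y + 1 / 2) ^ 2 - H' * (y + 1 / 2) ^ 2)) • (1 : A) := by
    simp only [weylProd, mul_add (R := A), add_mul (R := A), smul_mul_assoc, h.C_smul,
      mul_one, one_mul, mul_assoc]
    module
  have a5 : ((1 - H) • 1 + (2 : F) • C) * ((1 - H') • 1 + (2 : F) • C') =
      ((1 - H) * (1 - H')) • (1 : A) + (2 * (1 - H)) • C' + (2 * (1 - H')) • C +
        (4 : F) • (C * C') := by
    simp only [mul_add (R := A), add_mul (R := A), smul_mul_assoc, h.C_smul, mul_one, one_mul]
    module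
  subst hL
  simp only [k1, k2, k3, k4, h.quadComb_mul, a4, a5, map_sub,
    map_add, map_mul, map_div₀, map_pow, map_one, map_ofNat, map_neg,
    hσy, hσy', e1, e2, e3, e4]
  simp only [quadComb]
  match_scalars <;> (simp only [mul_one, add_zero, zero_add]; field_simp; ring)

/-- L commutes with C, with C' and with scalars fixed by both shifts, H and H' among them; the right
side of `tridiagonal` is built from these and L. -/
theorem tridiagonal_commute (h : IsRacahQuadruple σ σ' y H H' U D C C')
    (hy : ∀ n : ℤ, 2 * y + n ≠ 0) (hσy : σ y = y + 1) (hσy' : σ' y = y - 1)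
    (hH : σ H = H) (hσ'H : σ' H = H) (hσH' : σ H' = H') (hσ'H' : σ' H' = H') (L : A)
    (hL : L = quadComb (-1 / ((2 * y + 1) * (2 * y))) (-1 / ((2 * y - 1) * (2 * y)))
      (2 / ((2 * y + 1) * (2 * y - 1))) (2 / ((2 * y + 1) * (2 * y - 1)) * y ^ 2)
      (2 / ((2 * y + 1) * (2 * y - 1)) * y ^ 2) (2 / ((2 * y + 1) * (2 * y - 1)) * y ^ 4) U D C C') :
    Commute L (L * (L * y ^ 2 • 1 - (2 * y ^ 2) • L) + y ^ 2 • (L * L) +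
      (2 : F) • (L * y ^ 2 • 1 + y ^ 2 • L) - ((H + H' - 2) * y ^ 2) • (1 : A)) := by
  have a1 (x : A) : C' * (C * x) = C * (C' * x) := by rw [← mul_assoc, h.CC', mul_assoc]
  have hC : Commute L C := by
    rw [hL, commute_iff_eq]
    simp only [quadComb, mul_add (R := A), add_mul (R := A), smul_mul_assoc, h.C_smul, h.UC, h.DC,
      mul_one, one_mul, mul_assoc, h.CC']
  have hC' : Commute L C' := by
    rw [hL, commute_iff_eq]
    simp only [quadComb, mul_add (R := A), add_mul (R := A), smul_mul_assoc, h.C'_smul, h.UC',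
      h.DC', mul_one, one_mul, mul_assoc, h.CC', a1]
  have hs {f : F} (hf : σ f = f) (hf' : σ' f = f) {x : A} (hx : Commute L x) :
      Commute L (f • x) := by
    rw [commute_iff_eq, smul_mul_assoc, ← hx.eq, hL]
    simp only [quadComb, add_mul, smul_mul_assoc, h.U_smul, h.D_smul, mul_assoc, h.C_smul,
      h.C'_smul, hf, hf', one_mul]
    module
  have h2 : σ 2 = 2 := map_ofNat σ 2
  have h2' : σ' 2 = 2 := map_ofNat σ' 2
  rw [h.tridiagonal hy hσy hσy' L hL]
  refine Commute.add_right (Commute.sub_right (hs h2 h2' ((Commute.refl L).mul_right (Commute.refl L)))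
    (hs h2 h2' ((hC.add_right hC').mul_right (Commute.refl L))))
    (Commute.sub_right (hs h2 h2' (hC.mul_right hC')) (hs (by simp [h2]) (by simp [h2'])
      (Commute.mul_right ?_ ?_)))
  · exact (hs (by simp [hH]) (by simp [hσ'H]) (Commute.one_right L)).add_right (hs h2 h2' hC)
  · exact (hs (by simp [hσH']) (by simp [hσ'H']) (Commute.one_right L)).add_right (hs h2 h2' hC')

end IsRacahQuadruple
end RacahQuadruple

/-! ### Passage of the Weyl algebra relations to the next variable. -/

namespace IsRacahTriple

variable {F A : Type*} [Field F] [CharZero F] [Ring A] [Module F A] [IsScalarTower F A A]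
variable {σ σ' : F →+* F} {y H : F} {U D C : A}

theorem tripleComb_mul_smul (h : IsRacahTriple σ σ' y H U D C) (p q r s : F) {f : F}
    (hf : σ f = f) (hf' : σ' f = f) (x : A) :
    tripleComb p q r s U D C * (f • x) = f • (tripleComb p q r s U D C * x) := by
  simp only [tripleComb, add_mul, smul_mul_assoc, h.U_smul, h.D_smul, h.C_smul, hf, hf', one_mul]
  module

/-- The transfer carries triples at `y` to triples at a new variable `v`, whose shifts are `e` and
`e'`. -/
theorem transfer (h : IsRacahTriple σ σ' y H U D C) (hy : ∀ n : ℤ, 2 * y + n ≠ 0)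
    {d v : F} (hσy : σ y = y + 1) (hσy' : σ' y = y - 1)
    (hσv : σ v = v) (hσv' : σ' v = v) (hσd : σ d = d) (hσd' : σ' d = d)
    {τ τ' : F →+* F} {e e' : A} (he : ∀ (f : F) (x : A), e * (f • x) = τ f • (e * x))
    (he' : ∀ (f : F) (x : A), e' * (f • x) = τ' f • (e' * x)) (hee : e * e' = 1) (hee' : e' * e = 1)
    (eU : e * U = U * e) (eD : e * D = D * e) (eC : e * C = C * e)
    (eU' : e' * U = U * e') (eD' : e' * D = D * e') (eC' : e' * C = C * e')
    (hτy : τ y = y) (hτy' : τ' y = y) (hτd : τ d = d) (hτd' : τ' d = d)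
    (hτv : τ v = v + 1) (hτv' : τ' v = v - 1) {U' D' C' : A}
    (hU' : U' = transferOne d y v U D C * e) (hD' : D' = transferOne d y (-v) U D C * e')
    (hC' : C' = transferZero d y v U D C - v ^ 2 • (1 : A)) :
    U' * C' = C' * U' ∧ D' * C' = C' * D' ∧
    U' * D' = C' * C' + (2 * (v ^ 2 + v + 1 / 2)) • C'
      + ((v ^ 2 + v + 1 / 2) ^ 2 - H * (v + 1 / 2) ^ 2) • (1 : A) ∧
    D' * U' = C' * C' + (2 * (v ^ 2 - v + 1 / 2)) • C'
      + ((v ^ 2 - v + 1 / 2) ^ 2 - H * (v - 1 / 2) ^ 2) • (1 : A) := by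
  have shift1 (w : F) : e * transferOne d y w U D C = transferOne d y (τ w) U D C * e := by
    simp only [transferOne, tripleComb, mul_add (R := A), add_mul (R := A), he, smul_mul_assoc,
      map_add, map_mul, map_div₀, map_pow, map_sub, map_one, map_ofNat, hτy, hτd, mul_one, one_mul,
      eU, eD, eC]
  have shift1' (w : F) : e' * transferOne d y w U D C = transferOne d y (τ' w) U D C * e' := by
    simp only [transferOne, tripleComb, mul_add (R := A), add_mul (R := A), he', smul_mul_assoc,
      map_add, map_mul, map_div₀, map_pow, map_sub, map_one, map_ofNat, hτy', hτd', mul_one,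
      one_mul, eU', eD', eC']
  have shift0 (w : F) : e * transferZero d y w U D C = transferZero d y (τ w) U D C * e := by
    simp only [transferZero, tripleComb, mul_add (R := A), add_mul (R := A), he, smul_mul_assoc,
      map_add, map_mul, map_div₀, map_pow, map_sub, map_one, map_ofNat, hτy, hτd, mul_one, one_mul,
      eU, eD, eC]
  have shift0' (w : F) : e' * transferZero d y w U D C = transferZero d y (τ' w) U D C * e' := by
    simp only [transferZero, tripleComb, mul_add (R := A), add_mul (R := A), he', smul_mul_assoc,
      map_add, map_mul, map_div₀, map_pow, map_sub, map_one, map_ofNat, hτy', hτd', mul_one,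
      one_mul, eU', eD', eC']
  have even (w : F) : transferZero d y (-w) U D C = transferZero d y w U D C := by
    simp only [transferZero, even_two.neg_pow]
  have c0 (w : F) (f : F) (hf : σ f = f) (hf' : σ' f = f) (x : A) :
      transferZero d y w U D C * (f • x) = f • (transferZero d y w U D C * x) :=
    h.tripleComb_mul_smul _ _ _ _ hf hf' x
  have hC0 : C' = transferZero d y (-v) U D C - (-v) ^ 2 • (1 : A) := by
    rw [hC', even, even_two.neg_pow]
  have comm1 := h.transfer_comm hy (d := d) (v := v) hσy hσy' hσv hσv' hσd hσd'
  have comm2 := h.transfer_comm hy (d := d) (v := -v) hσy hσy' (by simp [hσv]) (by simp [hσv'])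
    hσd hσd'
  have mul1 := h.transfer_mul hy (d := d) (v := v) hσy hσy' hσv hσv' hσd hσd'
  have mul2 := h.transfer_mul hy (d := d) (v := -v) hσy hσy' (by simp [hσv]) (by simp [hσv'])
    hσd hσd'
  -- Needed for w = v and w = -v: the transfer Z depends on w only through w², so both signs lead to
  -- the same C'. The sum Z + w + 1/2 is C' + w² + w + 1/2, whose square is expanded.
  have expand (w : F) (hw : σ w = w) (hw' : σ' w = w) (hw2 : w ^ 2 = v ^ 2) :
      (transferZero d y w U D C + (w + 1 / 2) • (1 : A)) *
        (transferZero d y w U D C + (w + 1 / 2) • (1 : A)) -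
        (H * (w + 1 / 2) ^ 2) • (1 : A) = C' * C' + (2 * (w ^ 2 + w + 1 / 2)) • C'
      + ((w ^ 2 + w + 1 / 2) ^ 2 - H * (w + 1 / 2) ^ 2) • (1 : A) := by
    have hZ : transferZero d y w U D C = transferZero d y v U D C := by
      simp only [transferZero, hw2]
    have hZ' : transferZero d y w U D C + (w + 1 / 2) • (1 : A) =
        C' + (w ^ 2 + w + 1 / 2) • (1 : A) := by rw [hC', hZ, hw2]; module
    have hf : σ (w ^ 2 + w + 1 / 2) = w ^ 2 + w + 1 / 2 := by simp [hw, map_ofNat σ 2]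
    have hf' : σ' (w ^ 2 + w + 1 / 2) = w ^ 2 + w + 1 / 2 := by simp [hw', map_ofNat σ' 2]
    have cc : C' * ((w ^ 2 + w + 1 / 2) • (1 : A)) = (w ^ 2 + w + 1 / 2) • C' := by
      rw [hC', sub_mul, c0 _ _ hf hf', mul_one, smul_mul_assoc, one_mul, smul_sub]
      module
    rw [hZ', mul_add, add_mul, add_mul, cc, smul_mul_assoc, smul_mul_assoc, one_mul, one_mul]
    module
  refine ⟨?_, ?_, ?_, ?_⟩
  · rw [hU', hC', ← mul_assoc, comm1, mul_assoc, mul_assoc, mul_sub, shift0, sub_mul, he, hτv.symm,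
      map_pow, smul_mul_assoc, mul_one, one_mul]
  · rw [hD', hC0, ← mul_assoc, comm2, mul_assoc, mul_assoc, mul_sub, shift0', sub_mul, he', map_pow,
      smul_mul_assoc, mul_one, one_mul, show τ' (-v) = -v + 1 by rw [map_neg, hτv']; ring]
  -- Moving e to the right past the transfer at -v turns it into the one at -v - 1, the second
  -- factor in `transfer_mul`.
  · rw [hU', hD', mul_assoc, ← mul_assoc e, shift1, mul_assoc _ e, hee, mul_one,
      show τ (-v) = -v - 1 by rw [map_neg, hτv]; ring, mul1, expand v hσv hσv' rfl]
  · rw [hU', hD', mul_assoc, ← mul_assoc e', shift1', mul_assoc _ e', hee', mul_one,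
      show τ' v = - -v - 1 by rw [hτv']; ring, mul2,
      expand (-v) (by simp [hσv]) (by simp [hσv']) (by ring)]
    congr 3 <;> ring

end IsRacahTriple

/-! ### Transfer-matrix sums along a chain of shifts. -/

/-- A chain of commuting unit shifts `E i` of the variables `y i`, `1 ≤ i ≤ n`, of a field `K`. -/
structure ShiftChain (K : Type*) [Field K] [Algebra ℝ K] where
  n : ℕ
  E : ℕ → K ≃ₐ[ℝ] K
  y : ℕ → K
  d : ℕ → ℝ
  E_comm : ∀ i j f, E i (E j f) = E j (E i f)
  E_self : ∀ i, 1 ≤ i → i ≤ n → E i (y i) = y i + 1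
  E_other : ∀ i k, i ≠ k → E i (y k) = y k
  two_y_add_ne : ∀ i, 1 ≤ i → i ≤ n → ∀ m : ℤ, 2 * y i + m ≠ 0

namespace ShiftChain

variable {K : Type*} [Field K]

/-- The two-site coefficient in symmetric variables. -/
def coupling (s t : SignType) (d η y : K) : K :=
  if s = 0 then
    if t = 0 then y ^ 2 + η ^ 2 - d ^ 2 / 4 + d / 2 - 1 / 2 else (t * y + d / 2) ^ 2 - η ^ 2
  else
    if t = 0 then y ^ 2 - (s * η + d / 2) ^ 2
    else (s * η + t * y + d / 2) * (s * η + t * y + d / 2 + 1)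

/-- The one-site weight in symmetric variables. -/
def weight (s : SignType) (η : K) : K :=
  if s = 0 then 2 / ((2 * η + 1) * (2 * η - 1)) else 1 / ((2 * (s * η) + 1) * (2 * (s * η)))

theorem coupling_mem (T : Subfield K) {s t : SignType} {d η y : K} (hd : d ∈ T) (hη : η ∈ T)
    (hy : y ∈ T) : coupling s t d η y ∈ T := by
  have h2 : (2 : K) ∈ T := ofNat_mem T 2
  have h4 : (4 : K) ∈ T := ofNat_mem T 4
  have hc (s : SignType) : (s : K) ∈ T := by cases s <;> simp [T.neg_mem]
  unfold coupling
  split_ifs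
  all_goals repeat' first
    | assumption | exact hc _ | apply one_mem | apply sub_mem | apply add_mem | apply mul_mem
    | apply div_mem | apply pow_mem

theorem weight_mem (T : Subfield K) {s : SignType} {η : K} (hη : η ∈ T) : weight s η ∈ T := by
  have h2 : (2 : K) ∈ T := ofNat_mem T 2
  have hc (s : SignType) : (s : K) ∈ T := by cases s <;> simp [T.neg_mem]
  unfold weight
  split_ifs
  all_goals repeat' first
    | assumption | exact hc _ | apply one_mem | apply sub_mem | apply add_mem | apply mul_mem
    | apply div_mem

theorem coupling_zero_zero (d η y : K) :
    coupling 0 0 d η y = y ^ 2 + η ^ 2 - d ^ 2 / 4 + d / 2 - 1 / 2 := by simp [coupling]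

theorem coupling_zero_one (d η y : K) : coupling 0 1 d η y = (y + d / 2) ^ 2 - η ^ 2 := by
  simp [coupling]

theorem coupling_zero_neg (d η y : K) : coupling 0 (-1) d η y = (-y + d / 2) ^ 2 - η ^ 2 := by
  simp [coupling]

theorem coupling_one_zero (d η y : K) : coupling 1 0 d η y = y ^ 2 - (η + d / 2) ^ 2 := by
  simp [coupling]

theorem coupling_neg_zero (d η y : K) : coupling (-1) 0 d η y = y ^ 2 - (-η + d / 2) ^ 2 := by
  simp [coupling]

theorem coupling_one_one (d η y : K) :
    coupling 1 1 d η y = (η + y + d / 2) * (η + y + d / 2 + 1) := by simp [coupling]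

theorem coupling_one_neg (d η y : K) :
    coupling 1 (-1) d η y = (η + -y + d / 2) * (η + -y + d / 2 + 1) := by simp [coupling]

theorem coupling_neg_one (d η y : K) :
    coupling (-1) 1 d η y = (-η + y + d / 2) * (-η + y + d / 2 + 1) := by simp [coupling]

theorem coupling_neg_neg (d η y : K) :
    coupling (-1) (-1) d η y = (-η + -y + d / 2) * (-η + -y + d / 2 + 1) := by simp [coupling]

theorem weight_zero (η : K) : weight 0 η = 2 / ((2 * η + 1) * (2 * η - 1)) := by simp [weight]

theorem weight_one (η : K) : weight 1 η = 1 / ((2 * η + 1) * (2 * η)) := by simp [weight]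

theorem weight_neg (η : K) : weight (-1) η = 1 / ((2 * η - 1) * (2 * η)) := by
  rw [weight, if_neg (by decide), SignType.coe_neg, SignType.coe_one]
  congr 1
  ring

variable [Algebra ℝ K]

/-- An automorphism raised to a sign, as an operator. -/
def signPow (e : K ≃ₐ[ℝ] K) : SignType → Module.End ℝ K
  | .neg => e.symm.toLinearMap
  | .zero => 1
  | .pos => e.toLinearMap

variable (S : ShiftChain K)

/-- The partial sum over the states of the sites `1, …, i`, the state of site `i + 1` being fixed. -/
def row : ℕ → SignType → Module.End ℝ K
  | 0, s => coupling 0 s (algebraMap ℝ K (S.d 0)) (S.y 0) (S.y 1) • 1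
  | i + 1, s => ∑ t : SignType,
      (coupling t s (algebraMap ℝ K (S.d (i + 1))) (S.y (i + 1)) (S.y (i + 2)) *
        weight t (S.y (i + 1))) • (row i t * signPow (S.E (i + 1)) t)

theorem signPow_symm_apply {e : K ≃ₐ[ℝ] K} {X : Module.End ℝ K} (h : ∀ g, X (e g) = e (X g))
    (s : SignType) (g : K) : X (signPow e s g) = signPow e s (X g) := by
  cases s
  · rfl
  · change X (e.symm g) = e.symm (X g)
    rw [AlgEquiv.eq_symm_apply, ← h, AlgEquiv.apply_symm_apply]
  · exact h g

/-- An operator commutes with a partial sum as soon as it commutes with its ingredients. -/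
theorem apply_row {X : Module.End ℝ K} (T : Subfield K) (hr : ∀ r : ℝ, algebraMap ℝ K r ∈ T)
    (hT : ∀ f ∈ T, ∀ g, X (f * g) = f * X g) (i : ℕ) (hy : ∀ j ≤ i + 1, S.y j ∈ T)
    (hE : ∀ j, 1 ≤ j → j ≤ i → ∀ g, X (S.E j g) = S.E j (X g)) (s : SignType) (g : K) :
    X (S.row i s g) = S.row i s (X g) := by
  induction i generalizing s g with
  | zero =>
    exact hT _ (coupling_mem T (hr _) (hy 0 (by omega)) (hy 1 (by omega))) _
  | succ i ih =>
    simp only [row, LinearMap.sum_apply, map_sum, LinearMap.smul_apply, Module.End.mul_apply,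
      smul_eq_mul]
    refine Finset.sum_congr rfl fun t _ => ?_
    rw [hT _ (mul_mem (coupling_mem T (hr _) (hy _ (by omega)) (hy _ (by omega)))
      (weight_mem T (hy _ (by omega)))),
      ih (fun j hj => hy j (by omega)) (fun j hj hj' => hE j hj (by omega)),
      signPow_symm_apply (hE (i + 1) (by omega) le_rfl)]

/-- The functions that do not depend on `y 1, …, y (k - 1)`. -/
def fixed (k : ℕ) : Subfield K where
  carrier := {f | ∀ m, 1 ≤ m → m < k → S.E m f = f}
  mul_mem' ha hb m h1 h2 := by rw [map_mul, ha m h1 h2, hb m h1 h2]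
  one_mem' _ _ _ := map_one _
  add_mem' ha hb m h1 h2 := by rw [map_add, ha m h1 h2, hb m h1 h2]
  zero_mem' _ _ _ := map_zero _
  neg_mem' ha m h1 h2 := by rw [map_neg, ha m h1 h2]
  inv_mem' _ ha m h1 h2 := by rw [map_inv₀, ha m h1 h2]

theorem algebraMap_mem_fixed (k : ℕ) (r : ℝ) : algebraMap ℝ K r ∈ S.fixed k :=
  fun _ _ _ => AlgEquiv.commutes _ _

theorem y_mem_fixed {k j : ℕ} (h : k ≤ j) : S.y j ∈ S.fixed k :=
  fun m _ h2 => S.E_other m j (by omega)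

theorem y_zero_mem_fixed (k : ℕ) : S.y 0 ∈ S.fixed k :=
  fun m _ _ => S.E_other m 0 (by omega)

theorem E_mem_fixed {k : ℕ} (j : ℕ) {f : K} (hf : f ∈ S.fixed k) : S.E j f ∈ S.fixed k :=
  fun m h1 h2 => by rw [S.E_comm, hf m h1 h2]

theorem E_symm_mem_fixed {k : ℕ} (j : ℕ) {f : K} (hf : f ∈ S.fixed k) :
    (S.E j).symm f ∈ S.fixed k :=
  fun m h1 h2 => by
    rw [AlgEquiv.eq_symm_apply, S.E_comm, AlgEquiv.apply_symm_apply, hf m h1 h2]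

theorem E_symm_other {i k : ℕ} (h : i ≠ k) : (S.E i).symm (S.y k) = S.y k := by
  rw [AlgEquiv.symm_apply_eq, S.E_other i k h]

theorem E_symm_self {i : ℕ} (h1 : 1 ≤ i) (h2 : i ≤ S.n) : (S.E i).symm (S.y i) = S.y i - 1 := by
  rw [AlgEquiv.symm_apply_eq, map_sub, S.E_self i h1 h2, map_one, add_sub_cancel_right]

theorem E_symm_comm (i j : ℕ) (f : K) : S.E i ((S.E j).symm f) = (S.E j).symm (S.E i f) := by
  rw [AlgEquiv.eq_symm_apply, S.E_comm, AlgEquiv.apply_symm_apply]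

theorem E_symm_comm_symm (i j : ℕ) (f : K) :
    (S.E i).symm ((S.E j).symm f) = (S.E j).symm ((S.E i).symm f) := by
  rw [AlgEquiv.eq_symm_apply, S.E_symm_comm, AlgEquiv.apply_symm_apply]

/-- `row i` shifts only the sites 1, …, i, so functions free of these variables are scalars for it.
-/
theorem row_mul {i : ℕ} {f : K} (hf : f ∈ S.fixed (i + 1)) (s : SignType) (g : K) :
    S.row i s (f * g) = f * S.row i s g :=
  (S.apply_row (X := LinearMap.mulLeft ℝ f) ⊤ (fun _ => trivial)
    (fun a _ g => by simp only [LinearMap.mulLeft_apply]; ring) i (fun _ _ => trivial)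
    (fun j h1 h2 g => by simp only [LinearMap.mulLeft_apply, map_mul, hf j h1 (by omega)]) s g).symm

theorem row_E {i m : ℕ} (hm : i + 1 < m) (s : SignType) (g : K) :
    S.row i s (S.E m g) = S.E m (S.row i s g) := by
  -- The elements fixed by `E m`; as m > i + 1, they include all variables that enter the
  -- coefficients of `row i`.
  let T : Subfield K :=
    { carrier := {f | S.E m f = f}
      mul_mem' := fun {a b} ha hb => by
        change _ = _ at ha hb; change _ = _; rw [map_mul, ha, hb]
      one_mem' := map_one _
      add_mem' := fun {a b} ha hb => by
        change _ = _ at ha hb; change _ = _; rw [map_add, ha, hb]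
      zero_mem' := map_zero _
      neg_mem' := fun {a} ha => by change _ = _ at ha; change _ = _; rw [map_neg, ha]
      inv_mem' := fun a ha => by change _ = _ at ha; change _ = _; rw [map_inv₀, ha] }
  refine (S.apply_row (X := (S.E m).toLinearMap) T (fun r => AlgEquiv.commutes _ _)
    (fun a ha g => ?_) i (fun j hj => S.E_other m j (by omega)) (fun j _ _ g => S.E_comm _ _ _)
    s g).symm
  change S.E m (a * g) = a * S.E m g
  rw [map_mul, show S.E m a = a from ha]

theorem row_E_symm {i m : ℕ} (hm : i + 1 < m) (s : SignType) (g : K) :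
    S.row i s ((S.E m).symm g) = (S.E m).symm (S.row i s g) := by
  rw [AlgEquiv.eq_symm_apply, ← S.row_E hm, AlgEquiv.apply_symm_apply]

/-- The shift of the variable `y (i + 1)` on the functions free of `y 1, …, y i`. -/
def fixedE (k j : ℕ) : S.fixed k →+* S.fixed k :=
  ((S.E j : K →+* K).comp (S.fixed k).subtype).codRestrict (S.fixed k)
    fun f => S.E_mem_fixed j f.2

def fixedESymm (k j : ℕ) : S.fixed k →+* S.fixed k :=
  (((S.E j).symm : K →+* K).comp (S.fixed k).subtype).codRestrict (S.fixed k)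
    fun f => S.E_symm_mem_fixed j f.2

/-- The raising element at site `i + 1`. -/
def raise (i : ℕ) : Module.End ℝ K := S.row i 1 * (S.E (i + 1)).toLinearMap

/-- The lowering element at site `i + 1`. -/
def lower (i : ℕ) : Module.End ℝ K := S.row i (-1) * (S.E (i + 1)).symm.toLinearMap

/-- The central element at site `i + 1`. -/
def casimir (i : ℕ) : Module.End ℝ K := S.row i 0 - S.y (i + 1) ^ 2 • 1

theorem univ_signType : (Finset.univ : Finset SignType) = {1, 0, -1} := by decide

/-- The state 0 contributes `row i 0` = `casimir i` + y², which is where the constant coefficient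
comes from. -/
theorem row_succ (i : ℕ) (s : SignType) : S.row (i + 1) s = tripleComb
    (coupling 1 s (algebraMap ℝ K (S.d (i + 1))) (S.y (i + 1)) (S.y (i + 2)) *
        weight 1 (S.y (i + 1)))
    (coupling 0 s (algebraMap ℝ K (S.d (i + 1))) (S.y (i + 1)) (S.y (i + 2)) *
        weight 0 (S.y (i + 1)))
    (coupling (-1) s (algebraMap ℝ K (S.d (i + 1))) (S.y (i + 1)) (S.y (i + 2)) *
        weight (-1) (S.y (i + 1)))
    (coupling 0 s (algebraMap ℝ K (S.d (i + 1))) (S.y (i + 1)) (S.y (i + 2)) *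
        weight 0 (S.y (i + 1)) * S.y (i + 1) ^ 2)
    (S.raise i) (S.lower i) (S.casimir i) := by
  rw [row, univ_signType, Finset.sum_insert (by decide), Finset.sum_insert (by decide),
    Finset.sum_singleton, tripleComb, raise, lower, casimir]
  change _ • (_ * (S.E (i + 1)).toLinearMap) + (_ • (_ * 1) +
    _ • (_ * (S.E (i + 1)).symm.toLinearMap)) = _
  rw [mul_one]
  module

theorem row_succ_zero (i : ℕ) : S.row (i + 1) 0 = transferZero (algebraMap ℝ K (S.d (i + 1)))
    (S.y (i + 1)) (S.y (i + 2)) (S.raise i) (S.lower i) (S.casimir i) := by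
  rw [row_succ, transferZero]
  simp only [coupling_zero_zero, coupling_one_zero, coupling_neg_zero, weight_zero, weight_one,
    weight_neg]
  congr 1 <;> ring

theorem row_succ_one (i : ℕ) : S.row (i + 1) 1 = transferOne (algebraMap ℝ K (S.d (i + 1)))
    (S.y (i + 1)) (S.y (i + 2)) (S.raise i) (S.lower i) (S.casimir i) := by
  rw [row_succ, transferOne]
  simp only [coupling_zero_one, coupling_one_one, coupling_neg_one, weight_zero, weight_one,
    weight_neg]
  congr 1 <;> ring

theorem row_succ_neg (i : ℕ) : S.row (i + 1) (-1) = transferOne (algebraMap ℝ K (S.d (i + 1)))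
    (S.y (i + 1)) (-S.y (i + 2)) (S.raise i) (S.lower i) (S.casimir i) := by
  rw [row_succ, transferOne]
  simp only [coupling_zero_neg, coupling_one_neg, coupling_neg_neg, weight_zero, weight_one,
    weight_neg]
  congr 1 <;> ring

/-- The semilinearity over functions free of y_1, …, y_i is automatic from `row_mul`; only the four
multiplicative relations carry content. -/
theorem isRacahTriple_of_relations (i : ℕ)
    (h1 : S.raise i * S.casimir i = S.casimir i * S.raise i)
    (h2 : S.lower i * S.casimir i = S.casimir i * S.lower i)
    (h3 : S.raise i * S.lower i = S.casimir i * S.casimir i +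
        (2 * (S.y (i + 1) ^ 2 + S.y (i + 1) + 1 / 2)) • S.casimir i +
        ((S.y (i + 1) ^ 2 + S.y (i + 1) + 1 / 2) ^ 2 -
          4 * S.y 0 ^ 2 * (S.y (i + 1) + 1 / 2) ^ 2) • 1)
    (h4 : S.lower i * S.raise i = S.casimir i * S.casimir i +
        (2 * (S.y (i + 1) ^ 2 - S.y (i + 1) + 1 / 2)) • S.casimir i +
        ((S.y (i + 1) ^ 2 - S.y (i + 1) + 1 / 2) ^ 2 -
          4 * S.y 0 ^ 2 * (S.y (i + 1) - 1 / 2) ^ 2) • 1) :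
    IsRacahTriple (S.fixedE (i + 1) (i + 1)) (S.fixedESymm (i + 1) (i + 1))
      (⟨S.y (i + 1), S.y_mem_fixed le_rfl⟩ : S.fixed (i + 1))
      ⟨4 * S.y 0 ^ 2, mul_mem (ofNat_mem _ 4) (pow_mem (S.y_zero_mem_fixed _) 2)⟩
      (S.raise i) (S.lower i) (S.casimir i) := by
  refine ⟨fun f x => ?_, fun f x => ?_, fun f x => ?_, h1, h2, h3, h4⟩
  · ext g
    change S.row i 1 (S.E (i + 1) (f * x g)) = S.E (i + 1) f * S.row i 1 (S.E (i + 1) (x g))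
    rw [map_mul, S.row_mul (S.E_mem_fixed _ f.2)]
  · ext g
    change S.row i (-1) ((S.E (i + 1)).symm (f * x g)) =
      (S.E (i + 1)).symm f * S.row i (-1) ((S.E (i + 1)).symm (x g))
    rw [map_mul, S.row_mul (S.E_symm_mem_fixed _ f.2)]
  · ext g
    change S.row i 0 (f * x g) - S.y (i + 1) ^ 2 * (f * x g) =
      f * (S.row i 0 (x g) - S.y (i + 1) ^ 2 * x g)
    rw [S.row_mul f.2]
    ring

/-- The shifts of `y (i + 1)` on the functions free of `y 1, …, y i`, together with the raising,
lowering and central element at site `i + 1`. -/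
theorem isRacahTriple (i : ℕ) (hi : i + 1 ≤ S.n) :
    IsRacahTriple (S.fixedE (i + 1) (i + 1)) (S.fixedESymm (i + 1) (i + 1))
      (⟨S.y (i + 1), S.y_mem_fixed le_rfl⟩ : S.fixed (i + 1))
      ⟨4 * S.y 0 ^ 2, mul_mem (ofNat_mem _ 4) (pow_mem (S.y_zero_mem_fixed _) 2)⟩
      (S.raise i) (S.lower i) (S.casimir i) := by
  have : CharZero K := charZero_of_injective_algebraMap (algebraMap ℝ K).injective
  induction i with
  | zero =>
    -- At the first site the rows are multiplications and the relations are polynomial identities;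
    -- this is where H = 4 y_0² originates.
    have ey := S.E_self 1 le_rfl hi
    have ey' := S.E_symm_self le_rfl hi
    have e0 := S.E_other 1 0 (by omega)
    have e0' := S.E_symm_other (i := 1) (k := 0) (by omega)
    have m4 (e : K ≃ₐ[ℝ] K) : e 4 = 4 := map_ofNat e 4
    have m2 (e : K ≃ₐ[ℝ] K) : e 2 = 2 := map_ofNat e 2
    apply S.isRacahTriple_of_relations <;> ext g <;>
    simp only [raise, lower, casimir, row, coupling_zero_zero, coupling_zero_one,
      coupling_zero_neg, Module.End.mul_apply, LinearMap.sub_apply, LinearMap.smul_apply,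
      LinearMap.add_apply, AlgEquiv.toLinearMap_apply, Module.End.one_apply, smul_eq_mul, zero_add,
      map_sub, map_mul, map_add, map_pow, map_div₀, map_one, map_neg, m2, m4, ey, ey', e0, e0',
      AlgEquiv.commutes, AlgEquiv.apply_symm_apply, AlgEquiv.symm_apply_apply] <;>
    ring
  | succ i ih =>
    have e0 := S.E_other 1 0 (by omega)
    have hy (m : ℤ) : 2 * (⟨S.y (i + 1), S.y_mem_fixed le_rfl⟩ : S.fixed (i + 1)) + m ≠ 0 := by
      intro h
      apply S.two_y_add_ne (i + 1) (by omega) (by omega) m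
      exact (by push_cast; rfl : _ = _).symm.trans (congrArg Subtype.val h)
    -- The new variable v = y_{i+2} is constant for the shifts of y_{i+1}, and the shifts of y_{i+2}
    -- commute with everything built at site i+1.
    have key := (ih (by omega)).transfer hy
      (d := ⟨algebraMap ℝ K (S.d (i + 1)), S.algebraMap_mem_fixed _ _⟩)
      (v := ⟨S.y (i + 2), S.y_mem_fixed (by omega)⟩)
      (τ := S.fixedE (i + 1) (i + 2)) (τ' := S.fixedESymm (i + 1) (i + 2))
      (e := (S.E (i + 2)).toLinearMap) (e' := (S.E (i + 2)).symm.toLinearMap)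
      (U' := S.raise (i + 1)) (D' := S.lower (i + 1)) (C' := S.casimir (i + 1))
      (Subtype.ext (S.E_self _ (by omega) (by omega)))
      (Subtype.ext (S.E_symm_self (by omega) (by omega)))
      (Subtype.ext (S.E_other _ _ (by omega)))
      (Subtype.ext (S.E_symm_other (by omega)))
      (Subtype.ext ((S.E _).commutes _))
      (Subtype.ext ((S.E _).symm.commutes _))
      (fun f x => by ext g; exact map_mul (S.E (i + 2)) _ _)
      (fun f x => by ext g; exact map_mul (S.E (i + 2)).symm _ _)
      (by ext g; exact AlgEquiv.apply_symm_apply _ _)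
      (by ext g; exact AlgEquiv.symm_apply_apply _ _)
      (by
        ext g
        exact (S.row_E (m := i + 2) (by omega) _ _).symm.trans (congrArg _ (S.E_comm _ _ _)))
      (by
        ext g
        exact (S.row_E (m := i + 2) (by omega) _ _).symm.trans
          (congrArg _ (S.E_symm_comm _ _ _)))
      (by
        ext g
        change S.E (i + 2) (S.row i 0 g - S.y (i + 1) ^ 2 * g) =
          S.row i 0 (S.E (i + 2) g) - S.y (i + 1) ^ 2 * S.E (i + 2) g
        rw [S.row_E (by omega), map_sub, map_mul, map_pow, S.E_other _ _ (by omega)])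
      (by
        ext g
        exact (S.row_E_symm (m := i + 2) (by omega) _ _).symm.trans
          (congrArg _ (S.E_symm_comm _ _ _).symm))
      (by
        ext g
        exact (S.row_E_symm (m := i + 2) (by omega) _ _).symm.trans
          (congrArg _ (S.E_symm_comm_symm _ _ _)))
      (by
        ext g
        change (S.E (i + 2)).symm (S.row i 0 g - S.y (i + 1) ^ 2 * g) =
          S.row i 0 ((S.E (i + 2)).symm g) - S.y (i + 1) ^ 2 * (S.E (i + 2)).symm g
        rw [S.row_E_symm (by omega), map_sub, map_mul, map_pow, S.E_symm_other (by omega)])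
      (Subtype.ext (S.E_other _ _ (by omega)))
      (Subtype.ext (S.E_symm_other (by omega)))
      (Subtype.ext ((S.E _).commutes _))
      (Subtype.ext ((S.E _).symm.commutes _))
      (Subtype.ext (S.E_self _ (by omega) (by omega)))
      (Subtype.ext (S.E_symm_self (by omega) (by omega)))
      (by rw [raise, row_succ_one]; rfl)
      (by rw [lower, row_succ_neg]; rfl)
      (by rw [casimir, row_succ_zero]; rfl)
    exact S.isRacahTriple_of_relations _ key.1 key.2.1 key.2.2.1 key.2.2.2

end ShiftChain

/-! ### Reversal of a chain, and cutting the sum at a site. -/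

namespace ShiftChain

variable {K : Type*} [Field K] [Algebra ℝ K] (S : ShiftChain K)

/-- The chain of the sites `l, l - 1, …, 1`. -/
def reflect (l : ℕ) (hl : l ≤ S.n) : ShiftChain K where
  n := l
  -- Past the end, truncated subtraction would send several indices to site 0 and break `E_other`;
  -- hence the default values.
  E i := if i ≤ l then S.E (l + 1 - i) else AlgEquiv.refl
  y i := if i ≤ l + 1 then S.y (l + 1 - i) else 0
  d i := S.d (l - i)
  E_comm i j f := by
    split_ifs
    · exact S.E_comm _ _ _
    all_goals rfl
  E_self i h1 h2 := by
    rw [if_pos h2, if_pos (by omega), S.E_self _ (by omega) (by omega)]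
  E_other i k h := by
    split_ifs
    · exact S.E_other _ _ (by omega)
    · exact map_zero _
    all_goals rfl
  two_y_add_ne i h1 h2 := by
    rw [if_pos (by omega)]
    exact S.two_y_add_ne _ (by omega) (by omega)

/-- The sign by which the couplings fail to be symmetric. -/
def gauge (s : SignType) : K := if s = 0 then 1 else -1

/-- Exchanging the two sites changes the sign of a coupling exactly when one of the two states is 0
and the other is not. -/
theorem gauge_mul_coupling (s t : SignType) (d η y : K) :
    gauge s * coupling t s d η y = gauge t * coupling s t d y η := by
  unfold gauge coupling
  split_ifs <;> ring

theorem signPow_comm {e e' : K ≃ₐ[ℝ] K} (h : ∀ f, e (e' f) = e' (e f)) (s t : SignType) (g : K) :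
    signPow e s (signPow e' t g) = signPow e' t (signPow e s g) :=
  signPow_symm_apply (X := signPow e s)
    (fun g => (signPow_symm_apply (X := e'.toLinearMap) (fun g => (h g).symm) s g).symm) t g

/-- The sum is read from both ends up to site k+1. Reversing a coupling costs a `gauge` at each of
its ends. These signs cancel at every site passed over and are 1 at the right end, where the state
is 0, so one is left at the cut. The induction moves the cut one site to the left. -/
theorem row_split (l : ℕ) (hl : l ≤ S.n) (m k : ℕ) (hk : k + m + 1 = l) (g : K) :
    S.row l 0 g = ∑ s : SignType, gauge s * weight s (S.y (k + 1)) *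
      S.row k s ((S.reflect l hl).row m s (signPow (S.E (k + 1)) s g)) := by
  induction m generalizing k g with
  | zero =>
    obtain rfl : l = k + 1 := by omega
    simp only [row, LinearMap.sum_apply, LinearMap.smul_apply, Module.End.mul_apply, smul_eq_mul,
      Module.End.one_apply]
    refine Finset.sum_congr rfl fun t _ => ?_
    have h1 : (S.reflect (k + 1) hl).y 0 = S.y (k + 2) := rfl
    have h2 : (S.reflect (k + 1) hl).y 1 = S.y (k + 1) := rfl
    have h3 : (S.reflect (k + 1) hl).d 0 = S.d (k + 1) := rfl
    rw [h1, h2, h3, S.row_mul (coupling_mem _ (S.algebraMap_mem_fixed _ _)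
      (S.y_mem_fixed (by omega)) (S.y_mem_fixed le_rfl))]
    have := gauge_mul_coupling 0 t (algebraMap ℝ K (S.d (k + 1))) (S.y (k + 1)) (S.y (k + 2))
    rw [gauge, if_pos rfl, one_mul] at this
    rw [this]
    ring
  | succ m ih =>
    have hE : (S.reflect l hl).E (m + 1) = S.E (k + 2) :=
      (if_pos (by omega)).trans (congrArg S.E (by omega))
    have hE' : (S.reflect l hl).E (m + 2) = S.E (k + 1) :=
      (if_pos (by omega)).trans (congrArg S.E (by omega))
    have h1 : (S.reflect l hl).y (m + 1) = S.y (k + 2) :=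
      (if_pos (by omega)).trans (congrArg S.y (by omega))
    have h2 : (S.reflect l hl).y (m + 2) = S.y (k + 1) :=
      (if_pos (by omega)).trans (congrArg S.y (by omega))
    have h3 : (S.reflect l hl).d (m + 1) = S.d (k + 1) := congrArg S.d (by omega)
    rw [ih (k + 1) (by omega)]
    simp only [row, LinearMap.sum_apply, LinearMap.smul_apply, Module.End.mul_apply, smul_eq_mul,
      map_sum, Finset.mul_sum, hE, h1, h2, h3]
    rw [Finset.sum_comm]
    refine Finset.sum_congr rfl fun t _ => Finset.sum_congr rfl fun s _ => ?_
    have c1 : coupling s t (algebraMap ℝ K (S.d (k + 1))) (S.y (k + 2)) (S.y (k + 1)) ∈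
        S.fixed (k + 1) := coupling_mem _ (S.algebraMap_mem_fixed _ _)
      (S.y_mem_fixed (by omega)) (S.y_mem_fixed le_rfl)
    have c2 : weight s (S.y (k + 2)) ∈ S.fixed (k + 1) := weight_mem _ (S.y_mem_fixed (by omega))
    rw [S.row_mul (mul_mem c1 c2), signPow_comm (S.E_comm (k + 2) (k + 1)),
      ← signPow_symm_apply (X := (S.reflect l hl).row m s) (e := S.E (k + 1)) (fun g => ?_) t]
    · linear_combination (weight s (S.y (k + 2)) * weight t (S.y (k + 1)) *
        S.row k t ((S.reflect l hl).row m s (signPow (S.E (k + 1)) t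
          (signPow (S.E (k + 2)) s g)))) *
        gauge_mul_coupling s t (algebraMap ℝ K (S.d (k + 1))) (S.y (k + 1)) (S.y (k + 2))
    · rw [← hE']
      exact row_E _ (by omega) _ _

end ShiftChain

/-! ### The two triples meeting at a site, and the second tridiagonal relation for the chain. -/

namespace ShiftChain

variable {K : Type*} [Field K] [Algebra ℝ K] (S : ShiftChain K)

theorem reflect_E {l m k : ℕ} (hl : l ≤ S.n) (hk : k + m + 1 = l) :
    (S.reflect l hl).E (m + 1) = S.E (k + 1) :=
  (if_pos (by omega)).trans (congrArg S.E (by omega))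

theorem reflect_y {l m k : ℕ} (hl : l ≤ S.n) (hk : k + m + 1 = l) :
    (S.reflect l hl).y (m + 1) = S.y (k + 1) :=
  (if_pos (by omega)).trans (congrArg S.y (by omega))

/-- An operator on the left part of the chain commutes with the partial sums on the right. -/
theorem apply_reflect_row {l m k : ℕ} (hl : l ≤ S.n) (hk : k + m + 1 = l) {X : Module.End ℝ K}
    (hX : ∀ f ∈ S.fixed (k + 1), ∀ g, X (f * g) = f * X g)
    (hE : ∀ j, k + 1 < j → ∀ g, X (S.E j g) = S.E j (X g)) (s : SignType) (g : K) :
    X ((S.reflect l hl).row m s g) = (S.reflect l hl).row m s (X g) := by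
  refine (S.reflect l hl).apply_row (S.fixed (k + 1)) (S.algebraMap_mem_fixed _) hX m
    (fun j hj => ?_) (fun j h1 h2 g => ?_) s g
  · rw [show (S.reflect l hl).y j = S.y (l + 1 - j) from if_pos (by omega)]
    exact S.y_mem_fixed (by omega)
  · rw [show (S.reflect l hl).E j = S.E (l + 1 - j) from if_pos (by omega)]
    exact hE _ (by omega) g

variable {l m k : ℕ} (hl : l ≤ S.n)

/-- The functions on which an operator at site `k + 1` acts linearly from both sides. -/
abbrev middle (l m k : ℕ) (hl : l ≤ S.n) : Subfield K :=
  S.fixed (k + 1) ⊓ (S.reflect l hl).fixed (m + 1)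

def middleE (hk : k + m + 1 = l) : S.middle l m k hl →+* S.middle l m k hl :=
  ((S.E (k + 1) : K →+* K).comp (S.middle l m k hl).subtype).codRestrict (S.middle l m k hl)
    fun f => ⟨S.E_mem_fixed _ f.2.1, by
      have := (S.reflect l hl).E_mem_fixed (m + 1) f.2.2
      rwa [S.reflect_E hl hk] at this⟩

def middleESymm (hk : k + m + 1 = l) : S.middle l m k hl →+* S.middle l m k hl :=
  (((S.E (k + 1)).symm : K →+* K).comp (S.middle l m k hl).subtype).codRestrict
    (S.middle l m k hl)
    fun f => ⟨S.E_symm_mem_fixed _ f.2.1, by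
      have := (S.reflect l hl).E_symm_mem_fixed (m + 1) f.2.2
      rwa [S.reflect_E hl hk] at this⟩

theorem y_mem_middle (hk : k + m + 1 = l) : S.y (k + 1) ∈ S.middle l m k hl :=
  ⟨S.y_mem_fixed le_rfl, by rw [← S.reflect_y hl hk]; exact y_mem_fixed _ le_rfl⟩

theorem y_zero_mem_middle (hk : k + m + 1 = l) : S.y 0 ∈ S.middle l m k hl :=
  ⟨S.y_zero_mem_fixed _, by
    rw [show S.y 0 = (S.reflect l hl).y (l + 1) from
      ((if_pos le_rfl).trans (congrArg S.y (Nat.sub_self _))).symm]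
    exact y_mem_fixed _ (by omega)⟩

theorem y_last_mem_middle (hk : k + m + 1 = l) : S.y (l + 1) ∈ S.middle l m k hl :=
  ⟨S.y_mem_fixed (by omega), y_zero_mem_fixed (S.reflect l hl) _⟩

/-- The left and the right rows shift disjoint sets of variables, and y_{k+1} enters both only
through coefficients, so they commute. A single shift of y_{k+1} serves both sides, and UD and DU
split into a left and a right product, each known from its triple. -/
theorem isRacahQuadruple (hk : k + m + 1 = l) :
    IsRacahQuadruple (S.middleE hl hk) (S.middleESymm hl hk)
      (⟨S.y (k + 1), S.y_mem_middle hl hk⟩ : S.middle l m k hl)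
      ⟨4 * S.y 0 ^ 2, mul_mem (ofNat_mem _ 4) (pow_mem (S.y_zero_mem_middle hl hk) 2)⟩
      ⟨4 * S.y (l + 1) ^ 2, mul_mem (ofNat_mem _ 4) (pow_mem (S.y_last_mem_middle hl hk) 2)⟩
      (S.row k 1 * (S.reflect l hl).raise m) (S.row k (-1) * (S.reflect l hl).lower m)
      (S.casimir k) ((S.reflect l hl).casimir m) := by
  have hP := S.isRacahTriple k (by omega)
  have hQ := (S.reflect l hl).isRacahTriple m (by change m + 1 ≤ l; omega)
  set R := S.reflect l hl with hR
  have hy : R.y (m + 1) = S.y (k + 1) := S.reflect_y hl hk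
  have hE : R.E (m + 1) = S.E (k + 1) := S.reflect_E hl hk
  -- operators on the left and on the right commute
  have comm (X : Module.End ℝ K)
      (hX : ∀ f ∈ S.fixed (k + 1), ∀ g, X (f * g) = f * X g)
      (hE : ∀ j, k + 1 < j → ∀ g, X (S.E j g) = S.E j (X g)) (s : SignType) (g : K) :
      X (R.row m s g) = R.row m s (X g) := S.apply_reflect_row hl hk hX hE s g
  have comm0 (s t : SignType) (g : K) : S.row k s (R.row m t g) = R.row m t (S.row k s g) :=
    comm _ (fun f hf g => S.row_mul hf s g) (fun j hj g => S.row_E hj s g) t g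
  -- Conjugation by the shift of y_{k+1} affects only coefficients of the left row, so the result
  -- still commutes with the right rows.
  have comm1 (s t : SignType) (g : K) :
      S.E (k + 1) (S.row k s ((S.E (k + 1)).symm (R.row m t g))) =
        R.row m t (S.E (k + 1) (S.row k s ((S.E (k + 1)).symm g))) :=
    comm ((S.E (k + 1)).toLinearMap * S.row k s * (S.E (k + 1)).symm.toLinearMap)
      (fun f hf g => by
        change S.E (k + 1) (S.row k s ((S.E (k + 1)).symm (f * g))) =
          f * S.E (k + 1) (S.row k s ((S.E (k + 1)).symm g))
        rw [map_mul, S.row_mul (S.E_symm_mem_fixed _ hf), map_mul, AlgEquiv.apply_symm_apply])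
      (fun j hj g => by
        change S.E (k + 1) (S.row k s ((S.E (k + 1)).symm (S.E j g))) =
          S.E j (S.E (k + 1) (S.row k s ((S.E (k + 1)).symm g)))
        rw [← S.E_symm_comm, S.row_E hj, S.E_comm]) t g
  have comm2 (s t : SignType) (g : K) :
      (S.E (k + 1)).symm (S.row k s (S.E (k + 1) (R.row m t g))) =
        R.row m t ((S.E (k + 1)).symm (S.row k s (S.E (k + 1) g))) :=
    comm ((S.E (k + 1)).symm.toLinearMap * S.row k s * (S.E (k + 1)).toLinearMap)
      (fun f hf g => by
        change (S.E (k + 1)).symm (S.row k s (S.E (k + 1) (f * g))) =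
          f * (S.E (k + 1)).symm (S.row k s (S.E (k + 1) g))
        rw [map_mul, S.row_mul (S.E_mem_fixed _ hf), map_mul, AlgEquiv.symm_apply_apply])
      (fun j hj g => by
        change (S.E (k + 1)).symm (S.row k s (S.E (k + 1) (S.E j g))) =
          S.E j ((S.E (k + 1)).symm (S.row k s (S.E (k + 1) g)))
        rw [S.E_comm, S.row_E hj, ← S.E_symm_comm]) t g
  have pointP {f : K} (hf : f ∈ S.middle l m k hl) (s : SignType) (g : K) :
      S.row k s (f * g) = f * S.row k s g := S.row_mul hf.1 s g
  have pointQ {f : K} (hf : f ∈ S.middle l m k hl) (s : SignType) (g : K) :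
      R.row m s (f * g) = f * R.row m s g := R.row_mul hf.2 s g
  have y2 : S.y (k + 1) ^ 2 ∈ S.middle l m k hl := pow_mem (S.y_mem_middle hl hk) 2
  have casP (g : K) : S.casimir k g = S.row k 0 g - S.y (k + 1) ^ 2 * g := rfl
  have casQ (g : K) : R.casimir m g = R.row m 0 g - S.y (k + 1) ^ 2 * g := by
    rw [← hy]; rfl
  have raiseP (g : K) : S.raise k g = S.row k 1 (S.E (k + 1) g) := rfl
  have lowerP (g : K) : S.lower k g = S.row k (-1) ((S.E (k + 1)).symm g) := rfl
  have raiseQ (g : K) : R.raise m g = R.row m 1 (S.E (k + 1) g) := by rw [← hE]; rfl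
  have lowerQ (g : K) : R.lower m g = R.row m (-1) ((S.E (k + 1)).symm g) := by rw [← hE]; rfl
  refine ⟨fun f x => ?_, fun f x => ?_, fun f x => ?_, fun f x => ?_, ?_, ?_, ?_, ?_, ?_, ?_, ?_⟩
  · ext g
    change S.row k 1 (R.raise m (f * x g)) = S.E (k + 1) f * S.row k 1 (R.raise m (x g))
    rw [raiseQ, raiseQ, map_mul, pointQ (f := S.E (k + 1) f) (S.middleE hl hk f).2,
      pointP (f := S.E (k + 1) f) (S.middleE hl hk f).2]
  · ext g
    change S.row k (-1) (R.lower m (f * x g)) =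
      (S.E (k + 1)).symm f * S.row k (-1) (R.lower m (x g))
    rw [lowerQ, lowerQ, map_mul, pointQ (f := (S.E (k + 1)).symm f) (S.middleESymm hl hk f).2,
      pointP (f := (S.E (k + 1)).symm f) (S.middleESymm hl hk f).2]
  · ext g
    change S.casimir k (f * x g) = f * S.casimir k (x g)
    rw [casP, casP, pointP f.2]; ring
  · ext g
    change R.casimir m (f * x g) = f * R.casimir m (x g)
    rw [casQ, casQ, pointQ f.2]; ring
  · -- `U C`
    ext g
    have := congrArg (R.row m 1) (LinearMap.congr_fun hP.UC g)
    simp only [Module.End.mul_apply, raiseP, casP, map_sub] at this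
    simp only [Module.End.mul_apply, raiseQ, casP, map_sub, comm0] at this ⊢
    simp only [pointQ y2] at this
    exact this
  · ext g
    have := congrArg (R.row m (-1)) (LinearMap.congr_fun hP.DC g)
    simp only [Module.End.mul_apply, lowerP, casP, map_sub] at this
    simp only [Module.End.mul_apply, lowerQ, casP, map_sub, comm0] at this ⊢
    simp only [pointQ y2] at this
    exact this
  · ext g
    have := congrArg (S.row k 1) (LinearMap.congr_fun hQ.UC g)
    simp only [Module.End.mul_apply, casQ (R.raise m g), map_sub, pointP y2] at this
    simp only [Module.End.mul_apply]
    rw [this, casQ, comm0]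
  · ext g
    have := congrArg (S.row k (-1)) (LinearMap.congr_fun hQ.DC g)
    simp only [Module.End.mul_apply, casQ (R.lower m g), map_sub, pointP y2] at this
    simp only [Module.End.mul_apply]
    rw [this, casQ, comm0]
  · ext g
    simp only [Module.End.mul_apply, casP, casQ, map_sub, pointP y2, pointQ y2, comm0]
    ring
  · trans (S.raise k * S.lower k) * (R.raise m * R.lower m)
    · ext g
      simp only [Module.End.mul_apply, raiseP, lowerP, raiseQ, lowerQ]
      rw [comm1, AlgEquiv.symm_apply_apply]
    · refine congrArg₂ (· * ·) hP.UD (hQ.UD.trans ?_)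
      change _ + (2 * (R.y (m + 1) ^ 2 + R.y (m + 1) + 1 / 2)) • R.casimir m +
        ((R.y (m + 1) ^ 2 + R.y (m + 1) + 1 / 2) ^ 2 -
          4 * S.y (l + 1) ^ 2 * (R.y (m + 1) + 1 / 2) ^ 2) • 1 = _
      rw [hy]
      rfl
  · trans (S.lower k * S.raise k) * (R.lower m * R.raise m)
    · ext g
      simp only [Module.End.mul_apply, raiseP, lowerP, raiseQ, lowerQ]
      rw [comm2, AlgEquiv.apply_symm_apply]
    · refine congrArg₂ (· * ·) (hP.DU.trans ?_) (hQ.DU.trans ?_)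
      · change _ + (2 * (S.y (k + 1) ^ 2 - S.y (k + 1) + 1 / 2)) • S.casimir k +
          ((S.y (k + 1) ^ 2 - S.y (k + 1) + 1 / 2) ^ 2 -
            4 * S.y 0 ^ 2 * (S.y (k + 1) - 1 / 2) ^ 2) • 1 =
          _ + (2 * ((-S.y (k + 1)) ^ 2 + -S.y (k + 1) + 1 / 2)) • S.casimir k +
          (((-S.y (k + 1)) ^ 2 + -S.y (k + 1) + 1 / 2) ^ 2 -
            4 * S.y 0 ^ 2 * (-S.y (k + 1) + 1 / 2) ^ 2) • 1
        module
      · change _ + (2 * (R.y (m + 1) ^ 2 - R.y (m + 1) + 1 / 2)) • R.casimir m +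
          ((R.y (m + 1) ^ 2 - R.y (m + 1) + 1 / 2) ^ 2 -
            4 * S.y (l + 1) ^ 2 * (R.y (m + 1) - 1 / 2) ^ 2) • 1 =
          _ + (2 * ((-S.y (k + 1)) ^ 2 + -S.y (k + 1) + 1 / 2)) • R.casimir m +
          (((-S.y (k + 1)) ^ 2 + -S.y (k + 1) + 1 / 2) ^ 2 -
            4 * S.y (l + 1) ^ 2 * (-S.y (k + 1) + 1 / 2) ^ 2) • 1
        rw [hy]
        module

/-- `row_split` with the two zero rows written as C + y² and C' + y². The numerators -1 are the
gauge signs of the nonzero states. -/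
theorem row_eq_quadComb (hk : k + m + 1 = l) (y : S.middle l m k hl) (hy : (y : K) = S.y (k + 1)) :
    S.row l 0 = quadComb (-1 / ((2 * y + 1) * (2 * y))) (-1 / ((2 * y - 1) * (2 * y)))
      (2 / ((2 * y + 1) * (2 * y - 1))) (2 / ((2 * y + 1) * (2 * y - 1)) * y ^ 2)
      (2 / ((2 * y + 1) * (2 * y - 1)) * y ^ 2) (2 / ((2 * y + 1) * (2 * y - 1)) * y ^ 4)
      (S.row k 1 * (S.reflect l hl).raise m) (S.row k (-1) * (S.reflect l hl).lower m)
      (S.casimir k) ((S.reflect l hl).casimir m) := by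
  have hR : (S.reflect l hl).y (m + 1) = S.y (k + 1) := S.reflect_y hl hk
  have hE : (S.reflect l hl).E (m + 1) = S.E (k + 1) := S.reflect_E hl hk
  ext g
  rw [S.row_split l hl m k hk, univ_signType, Finset.sum_insert (by decide),
    Finset.sum_insert (by decide), Finset.sum_singleton, weight_zero, weight_one, weight_neg]
  change _ = -1 / ((2 * (y : K) + 1) * (2 * y)) *
      S.row k 1 ((S.reflect l hl).row m 1 ((S.reflect l hl).E (m + 1) g)) +
    -1 / ((2 * (y : K) - 1) * (2 * y)) *
      S.row k (-1) ((S.reflect l hl).row m (-1) (((S.reflect l hl).E (m + 1)).symm g)) +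
    2 / ((2 * (y : K) + 1) * (2 * y - 1)) * (S.row k 0 ((S.reflect l hl).row m 0 g -
      (S.reflect l hl).y (m + 1) ^ 2 * g) - S.y (k + 1) ^ 2 *
      ((S.reflect l hl).row m 0 g - (S.reflect l hl).y (m + 1) ^ 2 * g)) +
    2 / ((2 * (y : K) + 1) * (2 * y - 1)) * (y : K) ^ 2 * (S.row k 0 g - S.y (k + 1) ^ 2 * g) +
    2 / ((2 * (y : K) + 1) * (2 * y - 1)) * (y : K) ^ 2 *
      ((S.reflect l hl).row m 0 g - (S.reflect l hl).y (m + 1) ^ 2 * g) +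
    2 / ((2 * (y : K) + 1) * (2 * y - 1)) * (y : K) ^ 4 * g
  rw [hR, hE, hy, map_sub, S.row_mul (pow_mem (S.y_mem_fixed le_rfl) 2), gauge, gauge, gauge,
    if_pos rfl, if_neg (by decide), if_neg (by decide)]
  change _ * S.row k 1 ((S.reflect l hl).row m 1 (S.E (k + 1) g)) +
    (_ * S.row k 0 ((S.reflect l hl).row m 0 g) +
    _ * S.row k (-1) ((S.reflect l hl).row m (-1) ((S.E (k + 1)).symm g))) = _
  ring

/-- The second tridiagonal relation, for the full sum over the states of the sites `1, …, l` and
the square of the variable of one of these sites. -/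
theorem tridiagonal_row {l m k : ℕ} (hl : l ≤ S.n) (hk : k + m + 1 = l) (X L : Module.End ℝ K) (hX : X = S.y (k + 1) ^ 2 • 1)
    (hL : L = S.row l 0) (κ : Module.End ℝ K)
    (hκ : κ = (4 * S.y 0 ^ 2 + 4 * S.y (l + 1) ^ 2 - 2) • 1) :
    Commute L (L * L * X - 2 * (L * X * L) + X * L * L + 2 * (L * X + X * L) - κ * X) := by
  have hQ := S.isRacahQuadruple hl hk
  set y : S.middle l m k hl := ⟨S.y (k + 1), S.y_mem_middle hl hk⟩ with hy
  have hny (n : ℤ) : 2 * y + n ≠ 0 := by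
    intro h
    apply S.two_y_add_ne (k + 1) (by omega) (by omega) n
    exact (by push_cast; rfl : _ = _).symm.trans (congrArg Subtype.val h)
  have hLq := S.row_eq_quadComb hl hk y rfl
  have e0 : S.E (k + 1) (S.y 0) = S.y 0 := S.E_other _ _ (by omega)
  have e0' : (S.E (k + 1)).symm (S.y 0) = S.y 0 := S.E_symm_other (by omega)
  have e1 : S.E (k + 1) (S.y (l + 1)) = S.y (l + 1) := S.E_other _ _ (by omega)
  have e1' : (S.E (k + 1)).symm (S.y (l + 1)) = S.y (l + 1) := S.E_symm_other (by omega)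
  have m4 (e : K ≃ₐ[ℝ] K) : e 4 = 4 := map_ofNat e 4
  have : CharZero K := charZero_of_injective_algebraMap (algebraMap ℝ K).injective
  have key := hQ.tridiagonal_commute hny (Subtype.ext (S.E_self _ (by omega) (by omega)))
    (Subtype.ext (S.E_symm_self (by omega) (by omega)))
    (Subtype.ext (by change S.E (k + 1) (4 * S.y 0 ^ 2) = _; rw [map_mul, map_pow, e0, m4]))
    (Subtype.ext (by change (S.E (k + 1)).symm (4 * S.y 0 ^ 2) = _; rw [map_mul, map_pow, e0', m4]))
    (Subtype.ext (by change S.E (k + 1) (4 * S.y (l + 1) ^ 2) = _; rw [map_mul, map_pow, e1, m4]))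
    (Subtype.ext (by
      change (S.E (k + 1)).symm (4 * S.y (l + 1) ^ 2) = _; rw [map_mul, map_pow, e1', m4])) _ hLq
  rw [← hL] at key
  refine cast (congrArg (Commute L) (Eq.symm ?_)) key
  rw [hX, hκ]
  ext g
  change L (L (S.y (k + 1) ^ 2 * g)) - (2 : ℕ) • L (S.y (k + 1) ^ 2 * L g) +
    S.y (k + 1) ^ 2 * L (L g) + (2 : ℕ) • (L (S.y (k + 1) ^ 2 * g) + S.y (k + 1) ^ 2 * L g) -
    (4 * S.y 0 ^ 2 + 4 * S.y (l + 1) ^ 2 - 2) * (S.y (k + 1) ^ 2 * g) =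
    L (L (S.y (k + 1) ^ 2 * g) - 2 * S.y (k + 1) ^ 2 * L g) + S.y (k + 1) ^ 2 * L (L g) +
    2 * (L (S.y (k + 1) ^ 2 * g) + S.y (k + 1) ^ 2 * L g) -
    (4 * S.y 0 ^ 2 + 4 * S.y (l + 1) ^ 2 - 2) * S.y (k + 1) ^ 2 * g
  rw [map_sub, mul_assoc 2, two_mul (S.y (k + 1) ^ 2 * L g), map_add, two_nsmul, two_nsmul]
  ring

end ShiftChain

/-! ### Preservation of even polynomials. -/

namespace ShiftChain

variable {K : Type*} [Field K] [Algebra ℝ K] (S : ShiftChain K)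

/-- The divided differences of `f` under the shifts of `y m` are even in `y m` up to elements
of `V`. -/
def HasDifferences (V : Subalgebra ℝ K) (m : ℕ) (f : K) : Prop :=
  ∃ p ∈ V, ∃ q ∈ V, S.E m f = f + (2 * S.y m + 1) * (p + S.y m * q) ∧
    (S.E m).symm f = f + (1 - 2 * S.y m) * (p - S.y m * q)

/-- The product rule for differences, Δ(fg) = fΔg + gΔf + ΔfΔg. The last term has (2y+1)² in it; one
factor 2y+1 is multiplied out, which is possible since y² lies in the algebra. -/
theorem hasDifferences_of_adjoin {G : Set K} {m : ℕ}
    (hy : S.y m ^ 2 ∈ Algebra.adjoin ℝ G)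
    (hG : ∀ f ∈ G, S.HasDifferences (Algebra.adjoin ℝ G) m f) {f : K}
    (hf : f ∈ Algebra.adjoin ℝ G) : S.HasDifferences (Algebra.adjoin ℝ G) m f := by
  have : CharZero K := charZero_of_injective_algebraMap (algebraMap ℝ K).injective
  set V := Algebra.adjoin ℝ G
  induction hf using Algebra.adjoin_induction with
  | mem f hf => exact hG f hf
  | algebraMap r =>
    exact ⟨0, V.zero_mem, 0, V.zero_mem, by simp [AlgEquiv.commutes], by simp [AlgEquiv.commutes]⟩
  | add f g hf hg ihf ihg =>
    obtain ⟨p, hp, q, hq, e1, e2⟩ := ihf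
    obtain ⟨p', hp', q', hq', e1', e2'⟩ := ihg
    refine ⟨p + p', V.add_mem hp hp', q + q', V.add_mem hq hq', ?_, ?_⟩
    · rw [map_add, e1, e1']; ring
    · rw [map_add, e2, e2']; ring
  | mul f g hf hg ihf ihg =>
    obtain ⟨p, hp, q, hq, e1, e2⟩ := ihf
    obtain ⟨p', hp', q', hq', e1', e2'⟩ := ihg
    -- Even and odd part in y of f(p'+yq') + g(p+yq) + (2y+1)(p+yq)(p'+yq').
    refine ⟨f * p' + g * p + (p * p' + S.y m ^ 2 * (q * q')) +
      2 * (S.y m ^ 2 * (p * q' + q * p')), ?_,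
      f * q' + g * q + (p * q' + q * p') + 2 * (p * p' + S.y m ^ 2 * (q * q')), ?_, ?_, ?_⟩
    · exact V.add_mem (V.add_mem (V.add_mem (V.mul_mem hf hp') (V.mul_mem hg hp))
        (V.add_mem (V.mul_mem hp hp') (V.mul_mem hy (V.mul_mem hq hq'))))
        (V.mul_mem (ofNat_mem V 2) (V.mul_mem hy (V.add_mem (V.mul_mem hp hq') (V.mul_mem hq hp'))))
    · exact V.add_mem (V.add_mem (V.add_mem (V.mul_mem hf hq') (V.mul_mem hg hq))
        (V.add_mem (V.mul_mem hp hq') (V.mul_mem hq hp')))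
        (V.mul_mem (ofNat_mem V 2) (V.add_mem (V.mul_mem hp hp')
          (V.mul_mem hy (V.mul_mem hq hq'))))
    · rw [map_mul, e1, e1']; ring
    · rw [map_mul, e2, e2']; ring

/-- The partial sums map even polynomials to even polynomials, up to their dependence on the
variable of the last site. -/
theorem row_mem (V : Subalgebra ℝ K) {l : ℕ} (hl : l ≤ S.n) (hy0 : S.y 0 ^ 2 ∈ V)
    (hy : ∀ m, 1 ≤ m → m ≤ l → S.y m ^ 2 ∈ V)
    (hV : ∀ m, 1 ≤ m → m ≤ l → ∀ f ∈ V, S.HasDifferences V m f) (i : ℕ) (hi : i ≤ l)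
    {f : K} (hf : f ∈ V) : ∃ a ∈ V, ∃ b ∈ V, ∃ c ∈ V,
      S.row i 1 f = a * S.y (i + 1) ^ 2 + b * S.y (i + 1) + c ∧
      S.row i (-1) f = a * S.y (i + 1) ^ 2 - b * S.y (i + 1) + c ∧
      S.row i 0 f = a * (S.y (i + 1) ^ 2 - 1 / 2) + b / 2 - c := by
  have : CharZero K := charZero_of_injective_algebraMap (algebraMap ℝ K).injective
  have hr (r : ℝ) : algebraMap ℝ K r ∈ V := V.algebraMap_mem r
  have h2 : (2 : K)⁻¹ ∈ V := by have := hr 2⁻¹; rwa [map_inv₀, map_ofNat] at this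
  have n2 : (2 : K) ∈ V := ofNat_mem V 2
  -- One triple a, b, c governs all three rows. This link between `row i 0` and `row i (±1)` is what
  -- makes the poles cancel at the next site.
  induction i generalizing f with
  | zero =>
    refine ⟨f, hf, algebraMap ℝ K (S.d 0) * f, V.mul_mem (hr _) hf,
      ((algebraMap ℝ K (S.d 0) * 2⁻¹) ^ 2 - S.y 0 ^ 2) * f,
      V.mul_mem (V.sub_mem (V.pow_mem (V.mul_mem (hr _) h2) 2) hy0) hf, ?_, ?_, ?_⟩ <;>
    simp only [row, LinearMap.smul_apply, Module.End.one_apply, smul_eq_mul, coupling_zero_one,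
      coupling_zero_neg, coupling_zero_zero] <;> ring
  | succ i ih =>
    obtain ⟨p, hp, q, hq, e1, e2⟩ := hV (i + 1) (by omega) hi f hf
    obtain ⟨a0, ha0, a1, ha1, a2, ha2, ea, ea', ea0⟩ := ih (by omega) hf
    obtain ⟨b0, hb0, b1, hb1, b2, hb2, eb, eb', eb0⟩ := ih (by omega) hp
    obtain ⟨c0, hc0, c1, hc1, c2, hc2, ec, ec', ec0⟩ := ih (by omega) hq
    have hy := hy (i + 1) (by omega) hi
    set y := S.y (i + 1) with hydef
    have hd := hr (S.d (i + 1))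
    set d := algebraMap ℝ K (S.d (i + 1)) with hddef
    set v := S.y (i + 2) with hv
    have hyf : y ∈ S.fixed (i + 1) := S.y_mem_fixed le_rfl
    have h2f : (2 : K) ∈ S.fixed (i + 1) := ofNat_mem _ 2
    have u1 : S.row i 1 (S.E (i + 1) f) =
        S.row i 1 f + (2 * y + 1) * (S.row i 1 p + y * S.row i 1 q) := by
      rw [e1, map_add, S.row_mul (add_mem (mul_mem h2f hyf) (one_mem _)), map_add, S.row_mul hyf]
    have u2 : S.row i (-1) ((S.E (i + 1)).symm f) =
        S.row i (-1) f + (1 - 2 * y) * (S.row i (-1) p - y * S.row i (-1) q) := by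
      rw [e2, map_add, S.row_mul (sub_mem (one_mem _) (mul_mem h2f hyf)), map_sub, S.row_mul hyf]
    have key (s : SignType) : S.row (i + 1) s f =
        coupling 1 s d y v * weight 1 y * S.row i 1 (S.E (i + 1) f) +
        (coupling 0 s d y v * weight 0 y * S.row i 0 f +
        coupling (-1) s d y v * weight (-1) y * S.row i (-1) ((S.E (i + 1)).symm f)) := by
      rw [row, univ_signType, Finset.sum_insert (by decide), Finset.sum_insert (by decide),
        Finset.sum_singleton]
      rfl
    -- `row i 1 p + y * row i 1 q` is re + y·ro, with ro the element of `hro` and re that of `hre`.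
    have hro : b1 + c0 * y ^ 2 + c2 ∈ V := V.add_mem (V.add_mem hb1 (V.mul_mem hc0 hy)) hc2
    have hre : b0 * y ^ 2 + b2 + c1 * y ^ 2 ∈ V :=
      V.add_mem (V.add_mem (V.mul_mem hb0 hy) hb2) (V.mul_mem hc1 hy)
    have hne := S.two_y_add_ne (i + 1) (by omega) (by omega)
    have h0 : y ≠ 0 := fun e => hne 0 (by simp [← hydef, e])
    have h1 : 2 * y + 1 ≠ 0 := by simpa using hne 1
    have h3 : 2 * y - 1 ≠ 0 := by simpa [sub_eq_add_neg] using hne (-1)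
    have h1' : y * 2 + 1 ≠ 0 := by rwa [mul_comm]
    have h3' : y * 2 - 1 ≠ 0 := by rwa [mul_comm]
    -- Read off as the coefficients of v², v and 1 after adding the three states; the denominators
    -- 2y and 2y ± 1 drop out.
    refine ⟨a0 + (b1 + c0 * y ^ 2 + c2), V.add_mem ha0 hro,
      d * (a0 + (b1 + c0 * y ^ 2 + c2)) + a1 + 2 * (b0 * y ^ 2 + b2 + c1 * y ^ 2) +
        (b1 + c0 * y ^ 2 + c2), V.add_mem (V.add_mem (V.add_mem (V.mul_mem hd
          (V.add_mem ha0 hro)) ha1) (V.mul_mem n2 hre)) hro,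
      (d * 2⁻¹) ^ 2 * a0 + a2 + d * 2⁻¹ * a1 +
        (y ^ 2 + d * 2⁻¹ + (d * 2⁻¹) ^ 2) * (b1 + c0 * y ^ 2 + c2) +
        (d + 1) * (b0 * y ^ 2 + b2 + c1 * y ^ 2), ?_, ?_, ?_, ?_⟩
    · have hd2 : d * 2⁻¹ ∈ V := V.mul_mem hd h2
      exact V.add_mem (V.add_mem (V.add_mem (V.add_mem (V.mul_mem (V.pow_mem hd2 2) ha0) ha2)
        (V.mul_mem hd2 ha1)) (V.mul_mem (V.add_mem (V.add_mem hy hd2) (V.pow_mem hd2 2)) hro))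
        (V.mul_mem (V.add_mem hd V.one_mem) hre)
    · rw [key, u1, u2, ea, ea', ea0, eb, eb', ec, ec', coupling_one_one, coupling_zero_one,
        coupling_neg_one, weight_one, weight_zero, weight_neg]
      field_simp
      ring
    · rw [key, u1, u2, ea, ea', ea0, eb, eb', ec, ec', coupling_one_neg, coupling_zero_neg,
        coupling_neg_neg, weight_one, weight_zero, weight_neg]
      field_simp
      ring
    · rw [key, u1, u2, ea, ea', ea0, eb, eb', ec, ec', coupling_one_zero, coupling_zero_zero,
        coupling_neg_zero, weight_one, weight_zero, weight_neg]
      field_simp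
      ring

theorem row_zero_mem (V : Subalgebra ℝ K) {l : ℕ} (hl : l ≤ S.n) (hy0 : S.y 0 ^ 2 ∈ V)
    (hy : ∀ m, 1 ≤ m → m ≤ l + 1 → S.y m ^ 2 ∈ V)
    (hV : ∀ m, 1 ≤ m → m ≤ l → ∀ f ∈ V, S.HasDifferences V m f) {f : K} (hf : f ∈ V) :
    S.row l 0 f ∈ V := by
  have h2 : (2 : K)⁻¹ ∈ V := by
    have := V.algebraMap_mem 2⁻¹
    rwa [map_inv₀, map_ofNat] at this
  obtain ⟨a, ha, b, hb, c, hc, -, -, e⟩ :=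
    S.row_mem V hl hy0 (fun m h1 h2 => hy m h1 (by omega)) hV l le_rfl hf
  rw [e, one_div, div_eq_mul_inv]
  exact V.sub_mem (V.add_mem (V.mul_mem ha (V.sub_mem (hy _ (by omega) le_rfl) h2))
    (V.mul_mem hb h2)) hc

end ShiftChain

/-! ### The Racah operator as a transfer-matrix sum. -/

namespace RacahTD

open Finset

theorem shift_algebraMap {N : ℕ} (ν : Fin N → ℤ) (p : MvPolynomial (Fin N) ℝ) :
    shift ν (algebraMap (MvPolynomial (Fin N) ℝ) (RatField N) p) = algebraMap (MvPolynomial (Fin N) ℝ) (RatField N) (polyShift ν p) :=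
  IsFractionRing.algEquivOfAlgEquiv_algebraMap _ _

theorem polyShift_X {N : ℕ} (ν : Fin N → ℤ) (i : Fin N) :
    polyShift ν (MvPolynomial.X i) = MvPolynomial.X i + MvPolynomial.C (ν i : ℝ) :=
  MvPolynomial.aeval_X _ _

theorem ratField_algHom_ext {N : ℕ} {f g : RatField N →ₐ[ℝ] RatField N}
    (h : ∀ i, f (algebraMap (MvPolynomial (Fin N) ℝ) (RatField N) (MvPolynomial.X i)) =
      g (algebraMap (MvPolynomial (Fin N) ℝ) (RatField N) (MvPolynomial.X i))) : f = g := by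
  refine IsLocalization.algHom_ext (nonZeroDivisors (MvPolynomial (Fin N) ℝ)) ?_
  exact MvPolynomial.algHom_ext fun i => h i

theorem algebraMap_C {N : ℕ} (r : ℝ) :
    algebraMap (MvPolynomial (Fin N) ℝ) (RatField N) (MvPolynomial.C r) = cst N r :=
  (IsScalarTower.algebraMap_apply ℝ (MvPolynomial (Fin N) ℝ) (RatField N) r).symm

theorem shift_X {N : ℕ} (ν : Fin N → ℤ) (i : Fin N) :
    shift ν (algebraMap (MvPolynomial (Fin N) ℝ) (RatField N) (MvPolynomial.X i)) =
      algebraMap (MvPolynomial (Fin N) ℝ) (RatField N) (MvPolynomial.X i) + (ν i : RatField N) := by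
  rw [shift_algebraMap, polyShift_X, map_add, algebraMap_C, cst, map_intCast]

theorem shift_shift {N : ℕ} (ν μ : Fin N → ℤ) (f : RatField N) :
    shift ν (shift μ f) = shift (ν + μ) f := by
  have : (shift ν).toAlgHom.comp (shift μ).toAlgHom = (shift (ν + μ)).toAlgHom := by
    apply ratField_algHom_ext
    intro i
    change shift ν (shift μ _) = shift (ν + μ) _
    rw [shift_X, shift_X, map_add, shift_X, map_intCast, Pi.add_apply]
    push_cast
    ring
  exact DFunLike.congr_fun this f

theorem shift_zero {N : ℕ} (f : RatField N) : shift (0 : Fin N → ℤ) f = f := by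
  have : (shift (0 : Fin N → ℤ)).toAlgHom = AlgHom.id ℝ (RatField N) := by
    apply ratField_algHom_ext
    intro i
    change shift 0 _ = _
    rw [shift_X]
    simp
  exact DFunLike.congr_fun this f

theorem shift_symm {N : ℕ} (ν : Fin N → ℤ) (f : RatField N) :
    (shift ν).symm f = shift (-ν) f := by
  rw [AlgEquiv.symm_apply_eq, shift_shift, add_neg_cancel, shift_zero]

theorem shift_cst {N : ℕ} (ν : Fin N → ℤ) (r : ℝ) : shift ν (cst N r) = cst N r :=
  AlgEquiv.commutes _ _

/-- The multi-index with the entry `s` at the variable `x_m`. -/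
def unitAt (N m : ℕ) (s : ℤ) : Fin N → ℤ := fun j => if (j : ℕ) + 1 = m then s else 0

theorem shift_xv {N : ℕ} (M : ℝ) (ν : Fin N → ℤ) (k : ℕ) (h1 : 1 ≤ k) (h2 : k ≤ N) :
    shift ν (xv N M k) = xv N M k + (ν ⟨k - 1, by omega⟩ : RatField N) := by
  rw [xv, dif_pos ⟨h1, h2⟩, shift_X]

theorem shift_xv_of_not {N : ℕ} (M : ℝ) (ν : Fin N → ℤ) (k : ℕ) (h : ¬ (1 ≤ k ∧ k ≤ N)) :
    shift ν (xv N M k) = xv N M k := by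
  rw [xv, dif_neg h]
  split_ifs
  · exact map_zero _
  · exact shift_cst _ _

theorem two_xv_add_ne {N : ℕ} (M : ℝ) (k : ℕ) (h1 : 1 ≤ k) (h2 : k ≤ N) (c : ℝ) :
    2 * xv N M k + cst N c ≠ 0 := by
  intro h
  rw [xv, dif_pos ⟨h1, h2⟩, ← algebraMap_C,
    show (2 : RatField N) = algebraMap (MvPolynomial (Fin N) ℝ) _ 2 by rw [map_ofNat], ← map_mul,
    ← map_add, ← map_zero (algebraMap (MvPolynomial (Fin N) ℝ) (RatField N))] at h
  have h := IsFractionRing.injective (MvPolynomial (Fin N) ℝ) (RatField N) h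
  have e0 := congrArg (MvPolynomial.eval fun _ => (0 : ℝ)) h
  have e1 := congrArg (MvPolynomial.eval fun _ => (1 : ℝ)) h
  simp at e0 e1
  rw [e0] at e1
  norm_num at e1

noncomputable section

/-- The chain of the symmetric variables `x_k + ζ_k / 2`. -/
def racahChain (N : ℕ) (ζ : ℕ → ℝ) (M : ℝ) : ShiftChain (RatField N) where
  n := N
  E i := shift (unitAt N i 1)
  y i := xv N M i + cst N (ζ i / 2)
  d i := ζ (i + 1) - ζ i
  E_comm i j f := by rw [shift_shift, shift_shift, add_comm]
  E_self i h1 h2 := by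
    rw [map_add, shift_xv M _ i h1 h2, shift_cst, unitAt, if_pos (by simp; omega)]
    push_cast
    ring
  E_other i k h := by
    rw [map_add, shift_cst]
    by_cases hk : 1 ≤ k ∧ k ≤ N
    · rw [shift_xv M _ k hk.1 hk.2, unitAt, if_neg (by simp; omega), Int.cast_zero, add_zero]
    · rw [shift_xv_of_not M _ k hk]
  two_y_add_ne i h1 h2 m h := two_xv_add_ne M i h1 h2 (ζ i + m) <| by
    simp only [cst]
    rw [← h, mul_add, map_add, map_intCast, ← map_ofNat (algebraMap ℝ (RatField N)) 2, ← map_mul,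
      mul_div_cancel₀ _ (two_ne_zero' ℝ)]
    ring

end

theorem signPow_racahChain (N : ℕ) (ζ : ℕ → ℝ) (M : ℝ) (i : ℕ) (s : SignType) (f : RatField N) :
    ShiftChain.signPow ((racahChain N ζ M).E i) s f = shift (unitAt N i (s : ℤ)) f := by
  cases s
  · change f = shift (unitAt N i 0) f
    rw [show unitAt N i 0 = 0 by ext; simp [unitAt], shift_zero]
  · change (shift (unitAt N i 1)).symm f = shift (unitAt N i (-1)) f
    rw [shift_symm]
    congr 2
    ext
    simp only [unitAt, Pi.neg_apply]
    split_ifs <;> rfl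
  · rfl

/-- In u + z/2 the involution is a change of sign, so one formula covers the indices 1 and -1, and
the parameters enter only through w - z. -/
theorem Bfac_eq_coupling {K : Type} [Field K] [CharZero K] (s t : SignType) (z w u v : K) :
    Bfac s t z w u v = ShiftChain.coupling s t (w - z) (u + z / 2) (v + w / 2) := by
  have h2 : (2 : K) ≠ 0 := two_ne_zero
  unfold Bfac ShiftChain.coupling invol
  cases s <;> cases t <;> simp <;> field_simp <;> ring

theorem bfac_eq_weight {K : Type} [Field K] [CharZero K] (s : SignType) (z u : K) :
    (if s = 0 then 2 else 1) / bfac s z u = ShiftChain.weight s (u + z / 2) := by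
  have h2 : (2 : K) ≠ 0 := two_ne_zero
  unfold bfac ShiftChain.weight invol
  have e (x : K) : 1 / ((x + 1) * x) = 1 / ((2 * (x / 2) + 1) * (2 * (x / 2))) := by
    rw [mul_div_cancel₀ _ h2]
  cases s
  · change 2 / ((2 * u + z + 1) * (2 * u + z - 1)) = 2 / ((2 * (u + z / 2) + 1) * (2 * (u + z / 2) - 1))
    congr 1
    ring
  · change 1 / ((2 * (-u - z) + z + 1) * (2 * (-u - z) + z)) =
      1 / ((2 * (-1 * (u + z / 2)) + 1) * (2 * (-1 * (u + z / 2))))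
    rw [e]
    congr 1
    ring
  · change 1 / ((2 * u + z + 1) * (2 * u + z)) =
      1 / ((2 * (1 * (u + z / 2)) + 1) * (2 * (1 * (u + z / 2))))
    rw [e]
    congr 1
    ring

theorem ext0_snoc {l : ℕ} (ν : Fin l → SignType) (s : SignType) (k : ℕ) :
    ext0 (Fin.snoc ν s : Fin (l + 1) → SignType) k = if k = l + 1 then s else ext0 ν k := by
  unfold ext0
  split_ifs with h1 h2 h3 h4
  · subst h2
    exact Fin.snoc_last (α := fun _ => SignType) s ν
  · exact Fin.snoc_castSucc (α := fun _ => SignType) s ν ⟨k - 1, by omega⟩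
  all_goals first | rfl | omega

/-- The recursion for `row` unfolded, the state of the last site being the last entry of ν. -/
theorem row_eq_sum (N : ℕ) (ζ : ℕ → ℝ) (M : ℝ) (l : ℕ) (t : SignType) (f : RatField N) :
    (racahChain N ζ M).row l t f = ∑ ν : Fin l → SignType,
      (∏ k ∈ range (l + 1), ShiftChain.coupling (ext0 ν k)
        (if k = l then t else ext0 ν (k + 1)) (cst N (ζ (k + 1) - ζ k))
        ((racahChain N ζ M).y k) ((racahChain N ζ M).y (k + 1))) *
      (∏ k ∈ Icc 1 l, ShiftChain.weight (ext0 ν k) ((racahChain N ζ M).y k)) *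
      shift (fun i : Fin N => ((ext0 ν (i + 1) : SignType) : ℤ)) f := by
  set S := racahChain N ζ M
  induction l generalizing t f with
  | zero =>
    rw [Fintype.sum_unique, zero_add, prod_range_one, if_pos rfl, Icc_eq_empty (by simp),
      prod_empty, mul_one]
    have h (ν : Fin 0 → SignType) :
        (fun i : Fin N => ((ext0 ν (i + 1) : SignType) : ℤ)) = 0 := by
      ext i
      simp [ext0]
    rw [h, shift_zero]
    rfl
  | succ l ih =>
    rw [← (Fin.snocEquiv fun _ : Fin (l + 1) => SignType).sum_comp, Fintype.sum_prod_type]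
    simp only [ShiftChain.row, LinearMap.sum_apply, LinearMap.smul_apply, Module.End.mul_apply,
      smul_eq_mul, ih, mul_sum]
    refine sum_congr rfl fun s _ => sum_congr rfl fun ν _ => ?_
    have e (k : ℕ) : ext0 ((Fin.snocEquiv fun _ : Fin (l + 1) => SignType) (s, ν)) k =
        if k = l + 1 then s else ext0 ν k := ext0_snoc ν s k
    have e1 : ∏ k ∈ range (l + 1), ShiftChain.coupling (if k = l + 1 then s else ext0 ν k)
          (if k = l + 1 then t else if k + 1 = l + 1 then s else ext0 ν (k + 1))
          (cst N (ζ (k + 1) - ζ k)) (S.y k) (S.y (k + 1)) =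
        ∏ k ∈ range (l + 1), ShiftChain.coupling (ext0 ν k)
          (if k = l then s else ext0 ν (k + 1)) (cst N (ζ (k + 1) - ζ k)) (S.y k)
          (S.y (k + 1)) := by
      refine prod_congr rfl fun k hk => ?_
      rw [mem_range] at hk
      rw [if_neg (by omega), if_neg (by omega)]
      simp only [Nat.add_right_cancel_iff]
    have e2 : ∏ k ∈ Icc 1 l, ShiftChain.weight (if k = l + 1 then s else ext0 ν k) (S.y k) =
        ∏ k ∈ Icc 1 l, ShiftChain.weight (ext0 ν k) (S.y k) := by
      refine prod_congr rfl fun k hk => ?_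
      rw [mem_Icc] at hk
      rw [if_neg (by omega)]
    simp only [e]
    rw [prod_range_succ _ (l + 1), prod_Icc_succ_top (by omega), e1, e2, if_pos rfl, if_pos rfl,
      signPow_racahChain, shift_shift]
    have e3 : (fun i : Fin N => ((ext0 ν (i + 1) : SignType) : ℤ)) + unitAt N (l + 1) (s : ℤ) =
        fun i : Fin N => (((if (i : ℕ) + 1 = l + 1 then s else ext0 ν (i + 1)) : SignType) : ℤ) := by
      ext i
      simp only [Pi.add_apply, unitAt]
      split_ifs with h
      · rw [h, show ext0 ν (l + 1) = 0 from dif_neg (by omega)]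
        simp
      · rw [add_zero]
    rw [e3]
    change ShiftChain.coupling s t (cst N (ζ (l + 1 + 1) - ζ (l + 1))) _ _ * _ * _ = _
    ring

theorem prod_range_shift {K : Type} [CommMonoid K] (F : ℕ → K) (l : ℕ) :
    ∏ k ∈ range l, F (k + 1) = ∏ k ∈ Icc 1 l, F k := by
  induction l with
  | zero => simp
  | succ l ih => rw [prod_range_succ, ih, prod_Icc_succ_top (by omega)]

/-- The power of 2 supplies the numerators 2 of the weights at the sites in state 0. -/
theorem Ccoef_eq (N : ℕ) (ζ : ℕ → ℝ) (M : ℝ) (l : ℕ) (ν : Fin l → SignType) :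
    Ccoef N ζ M l ν = (∏ k ∈ range (l + 1), ShiftChain.coupling (ext0 ν k)
        (if k = l then 0 else ext0 ν (k + 1)) (cst N (ζ (k + 1) - ζ k))
        ((racahChain N ζ M).y k) ((racahChain N ζ M).y (k + 1))) *
      ∏ k ∈ Icc 1 l, ShiftChain.weight (ext0 ν k) ((racahChain N ζ M).y k) := by
  have h2 (k : ℕ) : cst N (ζ k) / 2 = cst N (ζ k / 2) := by
    rw [cst, cst, map_div₀, map_ofNat]
  have e1 : (2 : RatField N) ^ (univ.filter fun i => ν i = 0).card =
      ∏ k ∈ Icc 1 l, if ext0 ν k = 0 then 2 else 1 := by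
    rw [← prod_range_shift, ← Fin.prod_univ_eq_prod_range (fun k => if ext0 ν (k + 1) = 0 then
      (2 : RatField N) else 1), prod_ite, prod_const, prod_const_one, mul_one]
    congr 2
    ext i
    simp [ext0]
  have e2 : ∏ k ∈ Icc 1 l, ShiftChain.weight (ext0 ν k) ((racahChain N ζ M).y k) =
      (∏ k ∈ Icc 1 l, if ext0 ν k = 0 then 2 else 1) /
        ∏ k ∈ Icc 1 l, bfac (ext0 ν k) (cst N (ζ k)) (xv N M k) := by
    rw [← prod_div_distrib]
    refine prod_congr rfl fun k _ => ?_
    rw [bfac_eq_weight, h2]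
    rfl
  have e3 : ∏ k ∈ range (l + 1), ShiftChain.coupling (ext0 ν k)
        (if k = l then 0 else ext0 ν (k + 1)) (cst N (ζ (k + 1) - ζ k))
        ((racahChain N ζ M).y k) ((racahChain N ζ M).y (k + 1)) =
      ∏ k ∈ range (l + 1), Bfac (ext0 ν k) (ext0 ν (k + 1))
        (cst N (ζ k)) (cst N (ζ (k + 1))) (xv N M k) (xv N M (k + 1)) := by
    refine prod_congr rfl fun k hk => ?_
    rw [Bfac_eq_coupling, h2, h2]
    congr 1
    · split_ifs with h
      · rw [h, show ext0 ν (l + 1) = 0 from dif_neg (by omega)]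
      · rfl
    · exact map_sub _ _ _
  rw [Ccoef, e1, e2, e3]
  ring

/-- The potential term of the Racah difference operator. -/
noncomputable def racahPotential (N : ℕ) (ζ : ℕ → ℝ) (M : ℝ) (l : ℕ) : RatField N :=
  xv N M (l + 1) * (xv N M (l + 1) + cst N (ζ (l + 1))) +
        cst N ((ζ 0 + 1) * (ζ (l + 1) - 1) / 2)

theorem racahOp_eq (N : ℕ) (ζ : ℕ → ℝ) (M : ℝ) (l : ℕ) :
    racahOp N ζ M l = (racahChain N ζ M).row l 0 - racahPotential N ζ M l • 1 := by
  ext f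
  rw [racahOp, LinearMap.sub_apply, LinearMap.sub_apply, row_eq_sum, LinearMap.sum_apply]
  congr 1
  refine sum_congr rfl fun ν _ => ?_
  rw [← Ccoef_eq]
  rfl

end RacahTD

/-! ### The two tridiagonal relations for λ and the Racah operator. -/

namespace RacahTD

open Finset

/-- The left hand side of the first tridiagonal relation as a linear function of the second
generator. -/
noncomputable def cubicAd {R : Type*} [Ring R] [Algebra ℝ R] (ρ : ℝ) (a : R) : R →ₗ[ℝ] R :=
  (LinearMap.mulLeft ℝ a - LinearMap.mulRight ℝ a) ∘ₗ
    ((LinearMap.mulLeft ℝ a - LinearMap.mulRight ℝ a) ∘ₗ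
      (LinearMap.mulLeft ℝ a - LinearMap.mulRight ℝ a) +
      (2 : ℝ) • (LinearMap.mulLeft ℝ a + LinearMap.mulRight ℝ a) - ρ • LinearMap.id)

/-- For β = 2 the cubic terms are the double commutator [a,[a,b]], so the relation is ad a applied
to [a,[a,b]] + 2(ab + ba) - ρb. -/
theorem cubicAd_apply {R : Type*} [Ring R] [Algebra ℝ R] (ρ : ℝ) (a b : R) :
    cubicAd ρ a b = ⁅a, a ^ 2 * b - (2 : ℝ) • (a * b * a) + b * a ^ 2 -
      (-2 : ℝ) • (a * b + b * a) - ρ • b⁆ := by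
  simp only [cubicAd, LinearMap.comp_apply, LinearMap.sub_apply, LinearMap.add_apply,
    LinearMap.smul_apply, LinearMap.mulLeft_apply, LinearMap.mulRight_apply, LinearMap.id_apply,
    Ring.lie_def]
  congr 2 <;> (rw [two_smul, two_smul, neg_smul, two_smul]; noncomm_ring)

theorem exists_tdAlg_hom {R : Type*} [Ring R] [Algebra ℝ R] {ρ ρ' : ℝ} (a b : R)
    (h1 : cubicAd ρ a b = 0) (h2 : cubicAd ρ' b a = 0) :
    ∃ φ : TDAlg ℝ 2 (-2) (-2) ρ ρ' →ₐ[ℝ] R,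
      φ (genA 2 (-2) (-2) ρ ρ') = a ∧ φ (genAstar 2 (-2) (-2) ρ ρ') = b := by
  rw [cubicAd_apply] at h1 h2
  refine ⟨RingQuot.liftAlgHom ℝ ⟨FreeAlgebra.lift ℝ ![a, b], ?_⟩, ?_, ?_⟩
  · intro x y h
    cases h
    · simpa [Ring.lie_def] using h1
    · simpa [Ring.lie_def] using h2
  · simp [genA]
  · simp [genAstar]

theorem lamX_eq (N : ℕ) (ζ : ℕ → ℝ) (M : ℝ) (l : ℕ) :
    lamX N ζ M l = cst N (ζ (N + 1 - l) ^ 2 / 4) - (racahChain N ζ M).y (N + 1 - l) ^ 2 := by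
  have e : cst N (ζ (N + 1 - l) ^ 2 / 4) = cst N (ζ (N + 1 - l) / 2) ^ 2 := by
    rw [cst, cst, ← map_pow]
    congr 1
    ring
  have e' : cst N (1 + ζ (N + 1 - l)) = 1 + 2 * cst N (ζ (N + 1 - l) / 2) := by
    simp only [cst]
    rw [map_add, map_one, ← map_ofNat (algebraMap ℝ (RatField N)) 2, ← map_mul,
      mul_div_cancel₀ _ (two_ne_zero' ℝ)]
  rw [lamX, e, e']
  change _ = _ - (_ + cst N (ζ (N + 1 - l) / 2)) ^ 2
  ring

theorem shift_y {N : ℕ} (ζ : ℕ → ℝ) (M : ℝ) (ν : Fin N → ℤ) (k : ℕ) (h1 : 1 ≤ k) (h2 : k ≤ N) :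
    shift ν ((racahChain N ζ M).y k) =
      (racahChain N ζ M).y k + (ν ⟨k - 1, by omega⟩ : RatField N) := by
  change shift ν (_ + _) = _ + _ + _
  rw [map_add, shift_cst, shift_xv M ν k h1 h2]
  ring

/-- The first tridiagonal relation holds for a multiplication and an operator that shifts its
variable by at most one step. -/
theorem cubicAd_shift (N : ℕ) (ζ : ℕ → ℝ) (M : ℝ) (l : ℕ) (hl : 1 ≤ l) (hlN : l ≤ N)
    (c : RatField N) (ν : Fin N → ℤ) (hν : ∀ i, ν i = 0 ∨ ν i = 1 ∨ ν i = -1) :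
    cubicAd (ζ (N + 1 - l) ^ 2 - 1) (LinearMap.mulLeft ℝ (lamX N ζ M l))
      (LinearMap.mulLeft ℝ c * (shift ν).toLinearMap) = 0 := by
  ext f
  rw [cubicAd_apply, lamX_eq]
  have hc : cst N (ζ (N + 1 - l) ^ 2 - 1) = 4 * cst N (ζ (N + 1 - l) ^ 2 / 4) - 1 := by
    simp only [cst]
    rw [map_sub, map_one, ← map_ofNat (algebraMap ℝ (RatField N)) 4, ← map_mul,
      mul_div_cancel₀ _ (four_ne_zero' ℝ)]
  have hs := shift_y ζ M ν (N + 1 - l) (by omega) (by omega)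
  have h2 : (algebraMap ℝ (RatField N)) 2 = 2 := map_ofNat _ 2
  have h2' : (algebraMap ℝ (RatField N)) (-2) = -2 := by rw [map_neg, h2]
  simp only [Ring.lie_def, pow_two (LinearMap.mulLeft ℝ _), LinearMap.sub_apply,
    LinearMap.add_apply, LinearMap.smul_apply, Module.End.mul_apply, LinearMap.mulLeft_apply,
    AlgEquiv.toLinearMap_apply, LinearMap.zero_apply]
  simp only [map_mul, map_sub, map_pow, shift_cst, hs, Algebra.smul_def, hc, h2, h2']
  -- With a = c - y² and a' = c - (y+ν)² the relation multiplies the operator by (a-a')((a-a')² +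
  -- 2(a+a') - (4c-1)). The first factor vanishes for ν = 0, the second for ν = ±1.
  rcases hν ⟨N + 1 - l - 1, by omega⟩ with h | h | h <;> rw [h] <;> push_cast <;> ring

theorem cubicAd_lamX_racahOp (N : ℕ) (ζ : ℕ → ℝ) (M : ℝ) (l : ℕ) (hl : 1 ≤ l) (hlN : l ≤ N) :
    cubicAd (ζ (N + 1 - l) ^ 2 - 1) (LinearMap.mulLeft ℝ (lamX N ζ M l)) (racahOp N ζ M l) = 0 := by
  rw [racahOp, map_sub, map_sum, sum_eq_zero fun ν _ =>
    cubicAd_shift N ζ M l hl hlN _ _ fun i => ?_, zero_sub, neg_eq_zero]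
  · have h : (shift (0 : Fin N → ℤ)).toLinearMap = 1 := by
      ext f
      exact shift_zero f
    rw [← mul_one (LinearMap.mulLeft ℝ (_ + _)), ← h]
    exact cubicAd_shift N ζ M l hl hlN _ _ fun i => Or.inl rfl
  · generalize ext0 ν (i + 1) = s
    cases s <;> decide

theorem racahOp_mul (N : ℕ) (ζ : ℕ → ℝ) (M : ℝ) (l : ℕ) {f : RatField N}
    (hf : f ∈ (racahChain N ζ M).fixed (l + 1)) (g : RatField N) :
    racahOp N ζ M l (f * g) = f * racahOp N ζ M l g := by
  rw [racahOp_eq, LinearMap.sub_apply, LinearMap.sub_apply, ShiftChain.row_mul _ hf,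
    LinearMap.smul_apply, LinearMap.smul_apply, Module.End.one_apply, Module.End.one_apply,
    smul_eq_mul, smul_eq_mul]
  ring

theorem cubicAd_of_commute {R : Type*} [Ring R] [Algebra ℝ R] (ρ : ℝ) {a b : R}
    (h : Commute a b) : cubicAd ρ a b = 0 := by
  have h1 : (LinearMap.mulLeft ℝ a - LinearMap.mulRight ℝ a) b = 0 := by
    simp [h.eq]
  have h2 : Commute a (a * b + b * a) :=
    ((Commute.refl a).mul_right h).add_right (h.mul_right (Commute.refl a))
  have h3 : Commute a (a ^ 2 * b - (2 : ℝ) • (a * b * a) + b * a ^ 2 -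
      (-2 : ℝ) • (a * b + b * a) - ρ • b) := by
    have hp : Commute a (a ^ 2) := (Commute.refl a).pow_right 2
    exact ((((hp.mul_right h).sub_right (((((Commute.refl a).mul_right h).mul_right
      (Commute.refl a))).smul_right 2)).add_right (h.mul_right hp)).sub_right
      (h2.smul_right _)).sub_right (h.smul_right _)
  rw [cubicAd_apply, Ring.lie_def, h3.eq, sub_self]

/-- W commutes with L and X, so replacing L by L - W leaves commutators with X alone and changes
2(LX + XL) by -4WX, which joins the term ρX. The constant c drops out by linearity. -/
theorem cubicAd_sub_of_commute {R : Type*} [Ring R] [Algebra ℝ R] (r c : ℝ) {L W X : R}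
    (hLW : Commute L W) (hXW : Commute X W)
    (h : Commute L (L * L * X - 2 * (L * X * L) + X * L * L + 2 * (L * X + X * L) -
      (4 * W + algebraMap ℝ R r) * X)) :
    cubicAd r (L - W) (algebraMap ℝ R c - X) = 0 := by
  rw [map_sub, cubicAd_of_commute _ (Algebra.commute_algebraMap_right c _), zero_sub, neg_eq_zero]
  have h0 (Z : R) (hZ : Commute Z W) : (L - W) * Z - Z * (L - W) = L * Z - Z * L := by
    rw [sub_mul, mul_sub, hZ.eq]
    abel
  have h1 := h0 X hXW
  have h2 := h0 (L * X - X * L) ((hLW.mul_left hXW).sub_left (hXW.mul_left hLW))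
  have h3 : (L - W) ^ 2 * X - (2 : ℝ) • ((L - W) * X * (L - W)) + X * (L - W) ^ 2 -
      (-2 : ℝ) • ((L - W) * X + X * (L - W)) - r • X =
      L * L * X - 2 * (L * X * L) + X * L * L + 2 * (L * X + X * L) -
        (4 * W + algebraMap ℝ R r) * X := by
    have e1 : (L - W) ^ 2 * X - (2 : ℝ) • ((L - W) * X * (L - W)) + X * (L - W) ^ 2 =
        (L - W) * ((L - W) * X - X * (L - W)) - ((L - W) * X - X * (L - W)) * (L - W) := by
      rw [two_smul]
      noncomm_ring
    rw [e1, h1, h2, neg_smul, two_smul, add_mul _ _ X, ← Algebra.smul_def, mul_sub X, sub_mul L,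
      hXW.eq]
    noncomm_ring
  have hW : Commute W (L * L * X - 2 * (L * X * L) + X * L * L + 2 * (L * X + X * L) -
      (4 * W + algebraMap ℝ R r) * X) := by
    have a := hLW.symm
    have b := hXW.symm
    have two : Commute W (2 : R) := Commute.ofNat_right W 2
    have four : Commute W (4 : R) := Commute.ofNat_right W 4
    exact (((((a.mul_right a).mul_right b).sub_right (two.mul_right ((a.mul_right b).mul_right
      a))).add_right ((b.mul_right a).mul_right a)).add_right (two.mul_right
      ((a.mul_right b).add_right (b.mul_right a)))).sub_right (((four.mul_right
      (Commute.refl W)).add_right (Algebra.commute_algebraMap_right r W)).mul_right b)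
  rw [cubicAd_apply, h3, Ring.lie_def, (h.sub_left hW).eq, sub_self]

/-- Two cases: the variable of λ is among the shifted sites 1, …, l, or it is not and λ commutes
with the operator. -/
theorem cubicAd_racahOp_lamX (N : ℕ) (ζ : ℕ → ℝ) (M : ℝ) (l : ℕ) (hlN : l ≤ N) :
    cubicAd ((ζ 0 - ζ (l + 1) + 1) ^ 2 - 1) (racahOp N ζ M l)
      (LinearMap.mulLeft ℝ (lamX N ζ M l)) = 0 := by
  set S := racahChain N ζ M
  by_cases hj : N + 1 - l ≤ l
  · have hcomm (f : RatField N) (hf : f ∈ S.fixed (l + 1)) : Commute (S.row l 0) (f • 1) := by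
      ext g
      exact S.row_mul hf 0 g
    have hw : racahPotential N ζ M l = S.y (l + 1) ^ 2 - cst N (ζ (l + 1) ^ 2 / 4) +
        cst N ((ζ 0 + 1) * (ζ (l + 1) - 1) / 2) := by
      have e : cst N (ζ (l + 1) ^ 2 / 4) = cst N (ζ (l + 1) / 2) ^ 2 := by
        simp only [cst]
        rw [← map_pow]
        congr 1
        ring
      have e' : cst N (ζ (l + 1)) = 2 * cst N (ζ (l + 1) / 2) := by
        simp only [cst]
        rw [← map_ofNat (algebraMap ℝ (RatField N)) 2, ← map_mul, mul_div_cancel₀ _ (two_ne_zero' ℝ)]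
      rw [racahPotential, e, e']
      change _ = (_ + cst N (ζ (l + 1) / 2)) ^ 2 - _ + _
      ring
    -- Four times the potential plus ρ* equals H + H' - 2 for the end variables y_0 and y_{l+1};
    -- this is what forces the value of ρ*.
    have hκ : 4 * racahPotential N ζ M l + cst N ((ζ 0 - ζ (l + 1) + 1) ^ 2 - 1) =
        4 * S.y 0 ^ 2 + 4 * S.y (l + 1) ^ 2 - 2 := by
      have e0 : S.y 0 = cst N (ζ 0 / 2) := by
        change xv N M 0 + _ = _
        simp [xv]
      have e : 4 * (cst N ((ζ 0 + 1) * (ζ (l + 1) - 1) / 2) - cst N (ζ (l + 1) ^ 2 / 4)) +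
          cst N ((ζ 0 - ζ (l + 1) + 1) ^ 2 - 1) = 4 * cst N (ζ 0 / 2) ^ 2 - 2 := by
        simp only [cst]
        rw [← map_ofNat (algebraMap ℝ (RatField N)) 2, ← map_ofNat (algebraMap ℝ (RatField N)) 4,
          ← map_sub, ← map_mul, ← map_add, ← map_pow, ← map_mul, ← map_sub]
        congr 1
        ring
      rw [hw, e0]
      linear_combination e
    have hA : LinearMap.mulLeft ℝ (lamX N ζ M l) =
        algebraMap ℝ (Module.End ℝ (RatField N)) (ζ (N + 1 - l) ^ 2 / 4) -
          S.y (N + 1 - l) ^ 2 • 1 := by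
      ext g
      rw [lamX_eq, LinearMap.mulLeft_apply, sub_mul, LinearMap.sub_apply,
        Module.algebraMap_end_apply, Algebra.smul_def]
      rfl
    rw [hA, racahOp_eq]
    apply cubicAd_sub_of_commute
    · apply hcomm
      rw [hw]
      exact add_mem (sub_mem (pow_mem (S.y_mem_fixed le_rfl) 2) (S.algebraMap_mem_fixed _ _))
        (S.algebraMap_mem_fixed _ _)
    · ext g
      exact mul_left_comm _ _ _
    -- The cut is at site k + 1 = N + 1 - l, with m sites between it and the end l.
    · refine S.tridiagonal_row (m := l - (N + 1 - l)) (k := N - l) hlN (by omega) _ _ ?_ rfl _ ?_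
      · rw [show N - l + 1 = N + 1 - l by omega]
      · rw [← hκ]
        ext g
        rw [LinearMap.add_apply, Module.algebraMap_end_apply, Algebra.smul_def]
        change (4 : Module.End ℝ (RatField N)) (_ * g) + _ = (_ + _) * g
        rw [Module.End.ofNat_apply]
        simp only [nsmul_eq_mul]
        push_cast
        ring
  · have hmem : lamX N ζ M l ∈ S.fixed (l + 1) := by
      rw [lamX_eq]
      exact sub_mem (S.algebraMap_mem_fixed _ _) (pow_mem (S.y_mem_fixed (by omega)) 2)
    apply cubicAd_of_commute
    ext g
    exact racahOp_mul N ζ M l hmem g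

end RacahTD

namespace RacahTD

open Finset

/-! ### The homomorphism into the difference operators -/

theorem map_cubicAd {R S : Type*} [Ring R] [Algebra ℝ R] [Ring S] [Algebra ℝ S] (f : R →ₐ[ℝ] S)
    (ρ : ℝ) (a b : R) : f (cubicAd ρ a b) = cubicAd ρ (f a) (f b) := by
  simp only [cubicAd_apply, Ring.lie_def, map_sub, map_add, map_mul, map_pow, map_smul]

/-- Serves both homomorphisms: T is the algebra of difference operators in one case, the stabilizer
of the polynomials in the other. -/
theorem exists_tdAlg_hom_subalgebra {R : Type*} [Ring R] [Algebra ℝ R] (T : Subalgebra ℝ R)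
    {ρ ρ' : ℝ} {a b : R} (ha : a ∈ T) (hb : b ∈ T) (h1 : cubicAd ρ a b = 0)
    (h2 : cubicAd ρ' b a = 0) :
    ∃ φ : TDAlg ℝ 2 (-2) (-2) ρ ρ' →ₐ[ℝ] T,
      (φ (genA 2 (-2) (-2) ρ ρ') : R) = a ∧ (φ (genAstar 2 (-2) (-2) ρ ρ') : R) = b := by
  obtain ⟨φ, e1, e2⟩ := exists_tdAlg_hom (⟨a, ha⟩ : T) ⟨b, hb⟩
    (Subtype.ext ((map_cubicAd T.val ρ ⟨a, ha⟩ ⟨b, hb⟩).trans h1))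
    (Subtype.ext ((map_cubicAd T.val ρ' ⟨b, hb⟩ ⟨a, ha⟩).trans h2))
  exact ⟨φ, congrArg Subtype.val e1, congrArg Subtype.val e2⟩

theorem mulLeft_mem_diffOps {N : ℕ} (f : RatField N) : LinearMap.mulLeft ℝ f ∈ diffOps N :=
  Algebra.subset_adjoin (Or.inl (Or.inl ⟨f, rfl⟩))

/-- The multi-indices whose shift is a difference operator. -/
def shiftSubgroup (N : ℕ) : AddSubmonoid (Fin N → ℤ) where
  carrier := {ν | (shift ν).toLinearMap ∈ diffOps N}
  add_mem' {ν μ} hν hμ := by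
    have h : (shift (ν + μ)).toLinearMap = (shift ν).toLinearMap * (shift μ).toLinearMap := by
      ext f
      exact (shift_shift ν μ f).symm
    change (shift (ν + μ)).toLinearMap ∈ diffOps N
    rw [h]
    exact mul_mem hν hμ
  zero_mem' := by
    have h : (shift (0 : Fin N → ℤ)).toLinearMap = 1 := by
      ext f
      exact shift_zero f
    change (shift (0 : Fin N → ℤ)).toLinearMap ∈ diffOps N
    rw [h]
    exact one_mem _

theorem shift_mem_diffOps {N : ℕ} (ν : Fin N → ℤ) : (shift ν).toLinearMap ∈ diffOps N := by
  change ν ∈ shiftSubgroup N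
  rw [← univ_sum_single ν]
  refine sum_mem fun i _ => ?_
  have h1 : Pi.single i 1 ∈ shiftSubgroup N :=
    Algebra.subset_adjoin (Or.inl (Or.inr ⟨i, rfl⟩))
  have h2 : Pi.single i (-1) ∈ shiftSubgroup N :=
    Algebra.subset_adjoin (Or.inr ⟨i, rfl⟩)
  obtain ⟨k, hk | hk⟩ := (ν i).eq_nat_or_neg
  · have := nsmul_mem h1 k
    rwa [← Pi.single_smul, nsmul_eq_mul, mul_one, ← hk] at this
  · have := nsmul_mem h2 k
    rwa [← Pi.single_smul, nsmul_eq_mul, mul_neg, mul_one, ← hk] at this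

theorem racahOp_mem_diffOps (N : ℕ) (ζ : ℕ → ℝ) (M : ℝ) (l : ℕ) :
    racahOp N ζ M l ∈ diffOps N :=
  sub_mem (sum_mem fun _ _ => mul_mem (mulLeft_mem_diffOps _) (shift_mem_diffOps _))
    (mulLeft_mem_diffOps _)

theorem exists_hom_diffOps (N : ℕ) (ζ : ℕ → ℝ) (M : ℝ) (l : ℕ) (hl : 1 ≤ l) (hlN : l ≤ N) :
    ∃ φ : RacahTDAlg N ζ l →ₐ[ℝ] diffOps N,
      (φ (racahA N ζ l) : Module.End ℝ (RatField N)) = LinearMap.mulLeft ℝ (lamX N ζ M l) ∧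
      (φ (racahAstar N ζ l) : Module.End ℝ (RatField N)) = racahOp N ζ M l :=
  exists_tdAlg_hom_subalgebra (diffOps N) (mulLeft_mem_diffOps _) (racahOp_mem_diffOps N ζ M l)
    (cubicAd_lamX_racahOp N ζ M l hl hlN) (cubicAd_racahOp_lamX N ζ M l hlN)

/-! ### The action on polynomials -/

/-- The operators preserving a submodule. -/
def stabilizer {K : Type*} [AddCommGroup K] [Module ℝ K] (V : Submodule ℝ K) :
    Subalgebra ℝ (Module.End ℝ K) where
  carrier := {X | ∀ v ∈ V, X v ∈ V}
  mul_mem' hX hY v hv := hX _ (hY v hv)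
  add_mem' hX hY v hv := V.add_mem (hX v hv) (hY v hv)
  algebraMap_mem' r _ hv := V.smul_mem r hv

/-- The restriction of the operators preserving a submodule. -/
def stabilizerRestrict {K : Type*} [AddCommGroup K] [Module ℝ K] (V : Submodule ℝ K) :
    stabilizer V →ₐ[ℝ] Module.End ℝ V where
  toFun X := (X : Module.End ℝ K).restrict X.2
  map_one' := rfl
  map_mul' _ _ := rfl
  map_zero' := rfl
  map_add' _ _ := rfl
  commutes' _ := rfl

theorem xv_eq_xv_zero {N : ℕ} (M : ℝ) {k : ℕ} (h1 : 1 ≤ k) (h2 : k ≤ N) :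
    xv N M k = xv N 0 k := by
  rw [xv, xv, dif_pos ⟨h1, h2⟩, dif_pos ⟨h1, h2⟩]

/-- The generator `x_{i+1} (x_{i+1} + ζ_{i+1})` of the space of polynomials. -/
noncomputable def quadVar (N : ℕ) (ζ : ℕ → ℝ) (i : Fin N) : RatField N :=
  xv N 0 (i + 1) * (xv N 0 (i + 1) + cst N (ζ (i + 1)))

theorem quadVar_mem (N : ℕ) (ζ : ℕ → ℝ) (i : Fin N) : quadVar N ζ i ∈ polySpace N ζ :=
  Algebra.subset_adjoin ⟨i, rfl⟩

theorem y_sq_eq (N : ℕ) (ζ : ℕ → ℝ) (M : ℝ) (k : ℕ) :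
    (racahChain N ζ M).y k ^ 2 = xv N M k * (xv N M k + cst N (ζ k)) + cst N (ζ k ^ 2 / 4) := by
  have e : cst N (ζ k ^ 2 / 4) = cst N (ζ k / 2) ^ 2 := by
    simp only [cst]
    rw [← map_pow]
    congr 1
    ring
  have e' : cst N (ζ k) = 2 * cst N (ζ k / 2) := by
    simp only [cst]
    rw [← map_ofNat (algebraMap ℝ (RatField N)) 2, ← map_mul, mul_div_cancel₀ _ (two_ne_zero' ℝ)]
  rw [e, e']
  change (_ + cst N (ζ k / 2)) ^ 2 = _
  ring

theorem y_sq_mem (N : ℕ) (ζ : ℕ → ℝ) (M : ℝ) {k : ℕ} (hk : k ≤ N + 1) :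
    (racahChain N ζ M).y k ^ 2 ∈ polySpace N ζ := by
  have hc (r : ℝ) : cst N r ∈ polySpace N ζ := (polySpace N ζ).algebraMap_mem r
  rw [y_sq_eq]
  refine add_mem ?_ (hc _)
  by_cases h : 1 ≤ k ∧ k ≤ N
  · rw [xv_eq_xv_zero M h.1 h.2]
    obtain ⟨k, rfl⟩ := Nat.exists_eq_add_of_le' h.1
    exact quadVar_mem N ζ ⟨k, h.2⟩
  · have hx : xv N M k ∈ polySpace N ζ := by
      rw [xv, dif_neg h]
      split_ifs
      exacts [zero_mem _, hc _]
    exact mul_mem hx (add_mem hx (hc _))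

theorem hasDifferences_of_mem (N : ℕ) (ζ : ℕ → ℝ) (M : ℝ) {m : ℕ} (h1 : 1 ≤ m) (h2 : m ≤ N)
    {f : RatField N} (hf : f ∈ polySpace N ζ) :
    (racahChain N ζ M).HasDifferences (polySpace N ζ) m f := by
  refine (racahChain N ζ M).hasDifferences_of_adjoin (y_sq_mem N ζ M (by omega)) ?_ hf
  rintro _ ⟨i, rfl⟩
  have hz : xv N 0 (i + 1) * (xv N 0 (i + 1) + cst N (ζ (i + 1))) =
      (racahChain N ζ M).y (i + 1) ^ 2 - cst N (ζ (i + 1) ^ 2 / 4) := by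
    rw [y_sq_eq, xv_eq_xv_zero M (by omega) (by omega), add_sub_cancel_right]
  dsimp only
  rw [hz]
  by_cases h : m = i + 1
  · subst h
    -- (y ± 1)² - y² = 1 ± 2y, so p = 1 and q = 0.
    refine ⟨1, one_mem _, 0, zero_mem _, ?_, ?_⟩
    · rw [map_sub, map_pow, (racahChain N ζ M).E_self _ h1 h2, cst, AlgEquiv.commutes]
      ring
    · rw [map_sub, map_pow, (racahChain N ζ M).E_symm_self h1 h2, cst, AlgEquiv.commutes]
      ring
  · refine ⟨0, zero_mem _, 0, zero_mem _, ?_, ?_⟩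
    · rw [map_sub, map_pow, (racahChain N ζ M).E_other _ _ h, cst, AlgEquiv.commutes]
      ring
    · rw [map_sub, map_pow, (racahChain N ζ M).E_symm_other h, cst, AlgEquiv.commutes]
      ring

theorem racahOp_mem_polySpace (N : ℕ) (ζ : ℕ → ℝ) (M : ℝ) (l : ℕ) (hlN : l ≤ N)
    {f : RatField N} (hf : f ∈ polySpace N ζ) : racahOp N ζ M l f ∈ polySpace N ζ := by
  have hc (r : ℝ) : cst N r ∈ polySpace N ζ := (polySpace N ζ).algebraMap_mem r
  rw [racahOp_eq]
  refine sub_mem ((racahChain N ζ M).row_zero_mem (polySpace N ζ) hlN (y_sq_mem N ζ M (by omega))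
    (fun m _ h2 => y_sq_mem N ζ M (by omega))
    (fun m h1 h2 f hf => hasDifferences_of_mem N ζ M h1 (by omega) hf) hf) (mul_mem ?_ hf)
  have h := sub_mem (y_sq_mem N ζ M (k := l + 1) (by omega)) (hc (ζ (l + 1) ^ 2 / 4))
  rw [y_sq_eq, add_sub_cancel_right] at h
  exact add_mem h (hc _)

theorem lamX_mem_polySpace (N : ℕ) (ζ : ℕ → ℝ) (M : ℝ) (l : ℕ) (hl : 1 ≤ l) :
    lamX N ζ M l ∈ polySpace N ζ := by
  rw [lamX_eq]
  exact sub_mem ((polySpace N ζ).algebraMap_mem _) (y_sq_mem N ζ M (by omega))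

theorem exists_hom_polySpace (N : ℕ) (ζ : ℕ → ℝ) (M : ℝ) (l : ℕ) (hl : 1 ≤ l) (hlN : l ≤ N) :
    ∃ ψ : RacahTDAlg N ζ l →ₐ[ℝ] Module.End ℝ (polySpace N ζ), ∀ v : polySpace N ζ,
      (ψ (racahA N ζ l) v : RatField N) = lamX N ζ M l * (v : RatField N) ∧
      (ψ (racahAstar N ζ l) v : RatField N) = racahOp N ζ M l (v : RatField N) := by
  obtain ⟨φ, h1, h2⟩ := exists_tdAlg_hom_subalgebra (stabilizer (polySpace N ζ).toSubmodule)
    (a := LinearMap.mulLeft ℝ (lamX N ζ M l)) (b := racahOp N ζ M l)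
    (fun v hv => (polySpace N ζ).mul_mem (lamX_mem_polySpace N ζ M l hl) hv)
    (fun v hv => racahOp_mem_polySpace N ζ M l hlN hv)
    (cubicAd_lamX_racahOp N ζ M l hl hlN) (cubicAd_racahOp_lamX N ζ M l hlN)
  refine ⟨(stabilizerRestrict (polySpace N ζ).toSubmodule).comp φ, fun v => ⟨?_, ?_⟩⟩
  · exact LinearMap.congr_fun h1 v
  · exact LinearMap.congr_fun h2 v

end RacahTD

/-! ### Families of polynomials with prescribed leading exponents. -/

open scoped MonomialOrder

namespace MonomialOrder

open MvPolynomial Finset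

variable {σ F : Type*} [Field F] (m : MonomialOrder σ)

/-- Polynomials whose degrees run through all exponents are linearly independent. -/
theorem linearIndependent_of_degree {p : (σ →₀ ℕ) → MvPolynomial σ F} (h0 : ∀ d, p d ≠ 0)
    (hp : ∀ d, m.degree (p d) = d) : LinearIndependent F p := by
  classical
  rw [linearIndependent_iff']
  intro s g hg i hi
  by_contra hne
  -- At the largest exponent d with a nonzero coefficient, only `p d` contributes to the coefficient
  -- of the monomial d.
  obtain ⟨d, hd, hmax⟩ := (s.filter fun i => g i ≠ 0).exists_max_image m.toSyn
    ⟨i, mem_filter.mpr ⟨hi, hne⟩⟩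
  rw [mem_filter] at hd
  have hc := congrArg (coeff d) hg
  rw [coeff_sum, coeff_zero, sum_eq_single d, coeff_smul, smul_eq_mul] at hc
  · refine mul_ne_zero hd.2 ?_ hc
    have := m.leadingCoeff_ne_zero_iff.mpr (h0 d)
    rwa [leadingCoeff, hp] at this
  · intro e he hed
    rw [coeff_smul, smul_eq_mul]
    by_cases hge : g e = 0
    · rw [hge, zero_mul]
    · rw [m.coeff_eq_zero_of_lt, mul_zero]
      rw [hp]
      exact lt_of_le_of_ne (hmax e (mem_filter.mpr ⟨he, hge⟩)) fun h => hed (m.toSyn.injective h)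
  · exact fun h => absurd hd.1 h

/-- Polynomials whose degrees run through all exponents span. -/
theorem span_eq_top_of_degree {p : (σ →₀ ℕ) → MvPolynomial σ F} (h0 : ∀ d, p d ≠ 0)
    (hp : ∀ d, m.degree (p d) = d) : Submodule.span F (Set.range p) = ⊤ := by
  classical
  -- Well-founded induction on the exponent: up to a scalar, the monomial d is `p d` minus smaller
  -- monomials.
  have key (s : m.syn) : ∀ d, m.toSyn d = s →
      monomial d (1 : F) ∈ Submodule.span F (Set.range p) := by
    induction s using WellFoundedLT.induction with
    | ind s ih =>
      rintro d rfl
      have hc : coeff d (p d) ≠ 0 := by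
        have := m.leadingCoeff_ne_zero_iff.mpr (h0 d)
        rwa [leadingCoeff, hp] at this
      have hs : (monomial d) (coeff d (p d)) + ∑ e ∈ (p d).support.erase d,
          monomial e (coeff e (p d)) = p d := by
        rw [add_sum_erase (p d).support (fun e => monomial e (coeff e (p d)))
          (mem_support_iff.mpr hc), ← as_sum]
      have hm : monomial d (1 : F) = (coeff d (p d))⁻¹ • (p d - ∑ e ∈ (p d).support.erase d,
          monomial e (coeff e (p d))) := by
        rw [← eq_sub_iff_add_eq.mpr hs, smul_monomial, smul_eq_mul, inv_mul_cancel₀ hc]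
      rw [hm]
      refine Submodule.smul_mem _ _ (Submodule.sub_mem _ (Submodule.subset_span ⟨d, rfl⟩)
        (Submodule.sum_mem _ fun e he => ?_))
      rw [mem_erase] at he
      have hlt : e ≺[m] d := lt_of_le_of_ne
        ((m.le_degree he.2).trans_eq (congrArg m.toSyn (hp d))) fun h => he.1 (m.toSyn.injective h)
      rw [show monomial e (coeff e (p d)) = coeff e (p d) • monomial e (1 : F) by
        rw [smul_monomial, smul_eq_mul, mul_one]]
      exact Submodule.smul_mem _ _ (ih _ hlt e rfl)
  rw [eq_top_iff]
  intro f _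
  rw [f.as_sum]
  refine Submodule.sum_mem _ fun e _ => ?_
  rw [show monomial e (coeff e f) = coeff e f • monomial e (1 : F) by
    rw [smul_monomial, smul_eq_mul, mul_one]]
  exact Submodule.smul_mem _ _ (key _ e rfl)

/-- The degree of a sum of Newton type products in a variable and a polynomial of smaller degree. -/
theorem degree_sum_newton (a : σ) {v : MvPolynomial σ F} (hv : m.degree v ≺[m] Finsupp.single a 1)
    (n : ℕ) (c e : ℕ → F) (e' : ℕ → ℕ → F) (hc : c n ≠ 0) :
    let p := ∑ i ∈ range (n + 1), C (c i) * (∏ j ∈ range i, (C (e j) - X a)) *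
      ∏ j ∈ range (n - i), (C (e' i j) - v)
    p ≠ 0 ∧ m.degree p = Finsupp.single a n := by
  intro p
  have hX (r : F) : m.degree (C r - X a) = Finsupp.single a 1 := by
    rw [← neg_sub, m.degree_neg, m.degree_X_sub_C]
  have hX0 (r : F) : C r - X a ≠ 0 := fun h => by
    have := hX r
    rw [h, m.degree_zero] at this
    exact one_ne_zero (Finsupp.single_eq_zero.mp this.symm)
  have hP (i : ℕ) : m.degree (∏ j ∈ range i, (C (e j) - X a)) = Finsupp.single a i := by
    rw [m.degree_prod fun j _ => hX0 _, sum_congr rfl fun j _ => hX _, sum_const, card_range,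
      Finsupp.smul_single, smul_eq_mul, mul_one]
  have hV (r : F) : m.degree (C r - v) ≼[m] m.degree v := by
    refine m.degree_sub_le.trans ?_
    rw [m.degree_C, map_zero, max_eq_right (m.zero_le _)]
  have hsmul (i : ℕ) : m.toSyn (Finsupp.single a i) = i • m.toSyn (Finsupp.single a 1) := by
    rw [← map_nsmul, Finsupp.smul_single, smul_eq_mul, mul_one]
  have hQ (i k : ℕ) : m.toSyn (m.degree (∏ j ∈ range k, (C (e' i j) - v))) ≤
      k • m.toSyn (m.degree v) := by
    refine m.degree_prod_le.trans ?_
    rw [map_sum]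
    refine (sum_le_sum fun j _ => hV _).trans_eq ?_
    rw [sum_const, card_range]
  have hlow (i : ℕ) (hi : i ∈ range n) : coeff (Finsupp.single a n) (C (c i) *
      (∏ j ∈ range i, (C (e j) - X a)) * ∏ j ∈ range (n - i), (C (e' i j) - v)) = 0 ∧
      m.degree (C (c i) * (∏ j ∈ range i, (C (e j) - X a)) *
        ∏ j ∈ range (n - i), (C (e' i j) - v)) ≼[m] Finsupp.single a n := by
    rw [mem_range] at hi
    have hlt : m.degree (C (c i) * (∏ j ∈ range i, (C (e j) - X a)) *
        ∏ j ∈ range (n - i), (C (e' i j) - v)) ≺[m] Finsupp.single a n := by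
      -- A term with i < n has exponent at most i times that of `X a` plus n - i > 0 times that of
      -- v, and the latter is strictly smaller.
      refine m.degree_mul_le.trans_lt ?_
      rw [map_add]
      have h1 : m.toSyn (m.degree (C (c i) * ∏ j ∈ range i, (C (e j) - X a))) ≤
          i • m.toSyn (Finsupp.single a 1) := by
        refine m.degree_mul_le.trans ?_
        rw [m.degree_C, zero_add, hP, hsmul]
      have h2 : (n - i) • m.toSyn (m.degree v) < (n - i) • m.toSyn (Finsupp.single a 1) :=
        nsmul_lt_nsmul_right (by omega) hv
      refine (add_le_add h1 (hQ i (n - i))).trans_lt ((add_lt_add_right h2 _).trans_eq ?_)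
      rw [← add_nsmul, hsmul n, Nat.add_sub_cancel' hi.le]
    exact ⟨m.coeff_eq_zero_of_lt hlt, hlt.le⟩
  have htop : m.degree (C (c n) * (∏ j ∈ range n, (C (e j) - X a)) *
      ∏ j ∈ range (n - n), (C (e' n j) - v)) = Finsupp.single a n := by
    rw [Nat.sub_self, range_zero, prod_empty, mul_one, m.degree_mul (by simpa using hc)
      (prod_ne_zero_iff.mpr fun j _ => hX0 _), m.degree_C, zero_add, hP]
  have htop0 : C (c n) * (∏ j ∈ range n, (C (e j) - X a)) *
      ∏ j ∈ range (n - n), (C (e' n j) - v) ≠ 0 := by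
    rw [Nat.sub_self, range_zero, prod_empty, mul_one]
    exact mul_ne_zero (by simpa using hc) (prod_ne_zero_iff.mpr fun j _ => hX0 _)
  have hcoeff : coeff (Finsupp.single a n) p ≠ 0 := by
    rw [coeff_sum, sum_range_succ, sum_eq_zero fun i hi => (hlow i hi).1, zero_add]
    have := m.leadingCoeff_ne_zero_iff.mpr htop0
    rwa [leadingCoeff, htop] at this
  have hle : m.degree p ≼[m] Finsupp.single a n := by
    refine m.degree_sum_le.trans (Finset.sup_le fun i hi => ?_)
    rcases Nat.lt_succ_iff_lt_or_eq.mp (mem_range.mp hi) with h | rfl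
    · exact (hlow i (mem_range.mpr h)).2
    · rw [htop]
  exact ⟨fun h => hcoeff (by rw [h, coeff_zero]),
    m.toSyn.injective (le_antisymm hle (m.le_degree (mem_support_iff.mpr hcoeff)))⟩

end MonomialOrder

namespace RacahTD

open Finset

/-! ### The basis of Racah polynomials -/

theorem poch_eq_prod {K : Type} [Field K] (y : K) (n : ℕ) :
    poch y n = ∏ j ∈ range n, (y + j) := by
  induction n with
  | zero => simp [poch]
  | succ n ih => rw [prod_range_succ, ← ih, poch, ascPochhammer_succ_eval, poch]

theorem poch_ne_zero {K : Type} [Field K] {y : K} (h : ∀ m : ℕ, y ≠ -(m : K)) (n : ℕ) :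
    poch y n ≠ 0 := by
  rw [poch_eq_prod, prod_ne_zero_iff]
  exact fun j _ hj => h j (eq_neg_of_add_eq_zero_left hj)

theorem poch_cst (N : ℕ) (r : ℝ) (n : ℕ) : poch (cst N r) n = cst N (poch r n) := by
  simp only [poch_eq_prod, cst, map_prod, map_add, map_natCast]

/-- The product of two shifted factorials exchanged by `x ↦ -x - z` is a polynomial in
`x (x + z)`. -/
theorem poch_mul_poch {K : Type} [Field K] (p x z : K) (n : ℕ) :
    poch (p - x) n * poch (p + z + x) n =
      ∏ j ∈ range n, ((p + j) * (p + j + z) - x * (x + z)) := by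
  rw [poch_eq_prod, poch_eq_prod, ← prod_mul_distrib]
  exact prod_congr rfl fun j _ => by ring

/-- Each generator is a nonconstant polynomial in its own variable. -/
theorem algebraicIndependent_quadVar (N : ℕ) (ζ : ℕ → ℝ) :
    AlgebraicIndependent ℝ (quadVar N ζ) := by
  have h1 : AlgebraicIndependent ℝ fun i : Fin N =>
      algebraMap (MvPolynomial (Fin N) ℝ) (RatField N) (MvPolynomial.X i) :=
    (MvPolynomial.algebraicIndependent_X (Fin N) ℝ).map'
      (f := IsScalarTower.toAlgHom ℝ (MvPolynomial (Fin N) ℝ) (RatField N))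
      (IsFractionRing.injective (MvPolynomial (Fin N) ℝ) (RatField N))
  have hm (r : ℝ) : (Polynomial.X * (Polynomial.X + Polynomial.C r)).Monic :=
    Polynomial.monic_X.mul (Polynomial.monic_X_add_C r)
  have h2 := h1.polynomial_aeval_of_transcendental
    (f := fun i => Polynomial.X * (Polynomial.X + Polynomial.C (ζ (i + 1))))
    fun i => Polynomial.transcendental _ (by
      rw [Polynomial.Monic.natDegree_mul Polynomial.monic_X (Polynomial.monic_X_add_C _)]
      simp) (by
      rw [(hm _).leadingCoeff]
      exact one_mem _)
  convert! h2 using 2 with i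
  rw [quadVar, xv, dif_pos ⟨by omega, by omega⟩]
  simp [cst]

/-- The polynomial representing `x_k (x_k + ζ_k)` for `1 ≤ k ≤ N + 1`. -/
noncomputable def quadPoly (N : ℕ) (ζ : ℕ → ℝ) (M : ℝ) (k : ℕ) : MvPolynomial (Fin N) ℝ :=
  if h : 1 ≤ k ∧ k ≤ N then MvPolynomial.X ⟨k - 1, by omega⟩
  else MvPolynomial.C (M * (M + ζ (N + 1)))

theorem aeval_quadPoly (N : ℕ) (ζ : ℕ → ℝ) (M : ℝ) {k : ℕ} (h1 : 1 ≤ k) (h2 : k ≤ N + 1) :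
    MvPolynomial.aeval (quadVar N ζ) (quadPoly N ζ M k) =
      xv N M k * (xv N M k + cst N (ζ k)) := by
  rw [quadPoly]
  split_ifs with h
  · rw [MvPolynomial.aeval_X, quadVar, xv_eq_xv_zero M h.1 h.2]
    simp only [Nat.sub_add_cancel h1]
  · obtain rfl : k = N + 1 := by omega
    rw [xv, dif_neg h, if_neg (by omega), MvPolynomial.aeval_C]
    simp only [cst, map_mul, map_add]

/-- The coefficients of the one-variable Racah polynomial with parameters
`a + 1 = 2 p + u`, `n + a + b + 1 = n + 2 p + w - 1`. -/
noncomputable def racahCoeff (n p : ℕ) (u w : ℝ) (i : ℕ) : ℝ :=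
  poch (-(n : ℝ)) i * poch (n + 2 * p + w - 1) i / i.factorial * poch (2 * p + u + i) (n - i)

/-- The polynomial representing the `k`-th factor of the multivariable Racah polynomial. -/
noncomputable def racahFactor (N : ℕ) (ζ : ℕ → ℝ) (M : ℝ) (n : Fin N → ℕ) (k : ℕ) :
    MvPolynomial (Fin N) ℝ :=
  ∑ i ∈ range (idx n k + 1),
    MvPolynomial.C (racahCoeff (idx n k) (psum n (k - 1)) (ζ k - ζ 0) (ζ (k + 1) - ζ 0) i) *
    (∏ j ∈ range i, (MvPolynomial.C (((psum n (k - 1) : ℝ) + j) * (psum n (k - 1) + j + ζ k)) -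
      quadPoly N ζ M k)) *
    ∏ j ∈ range (idx n k - i), (MvPolynomial.C (((psum n (k - 1) : ℝ) + i + j) *
      (psum n (k - 1) + i + j + ζ (k + 1))) - quadPoly N ζ M (k + 1))

/-- The shifted factorials in x_k and x_{k+1} pair up by `poch_mul_poch`: the two numerator ones in
x_k, and the two from the prefactor in x_{k+1}. All others are constants collected in `racahCoeff`.
-/
theorem aeval_racahFactor (N : ℕ) (ζ : ℕ → ℝ) (M : ℝ) (n : Fin N → ℕ) {k : ℕ} (h1 : 1 ≤ k)
    (h2 : k ≤ N) : MvPolynomial.aeval (quadVar N ζ) (racahFactor N ζ M n k) =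
    racah1 (idx n k)
      (-(psum n (k - 1) : RatField N) + xv N M k)
      (2 * (psum n (k - 1) : RatField N) + cst N (ζ k - ζ 0 - 1))
      (cst N (ζ (k + 1) - ζ k - 1))
      ((psum n (k - 1) : RatField N) - xv N M (k + 1) - 1)
      ((psum n (k - 1) : RatField N) + cst N (ζ k) + xv N M (k + 1)) := by
  rw [racahFactor, racah1, map_sum]
  refine sum_congr rfl fun i _ => ?_
  generalize idx n k = d
  generalize psum n (k - 1) = p
  have a1 : -(-(p : RatField N) + xv N M k) = p - xv N M k := by ring
  have a2 : -(p : RatField N) + xv N M k + (p - xv N M (k + 1) - 1) +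
      (p + cst N (ζ k) + xv N M (k + 1)) + 1 = p + cst N (ζ k) + xv N M k := by ring
  have a3 : (p : RatField N) - xv N M (k + 1) - 1 + 1 + i = p + i - xv N M (k + 1) := by ring
  have a4 : cst N (ζ (k + 1) - ζ k - 1) + (p + cst N (ζ k) + xv N M (k + 1)) + 1 + i =
      p + i + cst N (ζ (k + 1)) + xv N M (k + 1) := by
    simp only [cst, map_sub, map_one]
    ring
  have a5 : (-(d : RatField N)) = cst N (-(d : ℝ)) := by simp only [cst, map_neg, map_natCast]
  have a6 : (d : RatField N) + (2 * p + cst N (ζ k - ζ 0 - 1)) + cst N (ζ (k + 1) - ζ k - 1) + 1 =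
      cst N (d + 2 * p + (ζ (k + 1) - ζ 0) - 1) := by
    simp only [cst, map_add, map_sub, map_mul, map_one, map_natCast, map_ofNat]
    ring
  have a7 : (2 * (p : RatField N) + cst N (ζ k - ζ 0 - 1)) + 1 + i =
      cst N (2 * p + (ζ k - ζ 0) + i) := by
    simp only [cst, map_add, map_sub, map_mul, map_one, map_natCast, map_ofNat]
    ring
  have b1 := poch_mul_poch (p : RatField N) (xv N M k) (cst N (ζ k)) i
  have b2 := poch_mul_poch (p + i : RatField N) (xv N M (k + 1)) (cst N (ζ (k + 1))) (d - i)
  have c1 : MvPolynomial.aeval (quadVar N ζ) (∏ j ∈ range i,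
      (MvPolynomial.C (((p : ℝ) + j) * (p + j + ζ k)) - quadPoly N ζ M k)) =
      ∏ j ∈ range i, (((p : RatField N) + j) * (p + j + cst N (ζ k)) -
        xv N M k * (xv N M k + cst N (ζ k))) := by
    rw [map_prod]
    refine prod_congr rfl fun j _ => ?_
    rw [map_sub, aeval_quadPoly N ζ M h1 (by omega), MvPolynomial.aeval_C]
    simp only [cst, map_add, map_mul, map_natCast]
  have c2 : MvPolynomial.aeval (quadVar N ζ) (∏ j ∈ range (d - i),
      (MvPolynomial.C (((p : ℝ) + i + j) * (p + i + j + ζ (k + 1))) - quadPoly N ζ M (k + 1))) =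
      ∏ j ∈ range (d - i), (((p : RatField N) + i + j) * (p + i + j + cst N (ζ (k + 1))) -
        xv N M (k + 1) * (xv N M (k + 1) + cst N (ζ (k + 1)))) := by
    rw [map_prod]
    refine prod_congr rfl fun j _ => ?_
    rw [map_sub, aeval_quadPoly N ζ M (by omega) (by omega), MvPolynomial.aeval_C]
    simp only [cst, map_add, map_mul, map_natCast]
  rw [map_mul, map_mul, c1, c2, ← b1, ← b2, a1, a2, a3, a4, a5, a6, a7, MvPolynomial.aeval_C,
    racahCoeff, map_mul, map_div₀, map_mul, map_natCast]
  simp only [poch_cst]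
  ring

/-- The factors of the second shifted factorial are w + (n - 1 + 2p + j); they vanish only if w is a
nonpositive integer. The third factorial is empty for i = n. -/
theorem racahCoeff_ne_zero {n p : ℕ} (u : ℝ) {w : ℝ} (hw : ∀ m : ℕ, w ≠ -(m : ℝ)) :
    racahCoeff n p u w n ≠ 0 := by
  rw [racahCoeff, Nat.sub_self]
  refine mul_ne_zero (div_ne_zero (mul_ne_zero ?_ ?_) (by positivity)) (by simp [poch])
  · rw [poch_eq_prod, prod_ne_zero_iff]
    intro j hj h
    rw [mem_range] at hj
    have : (j : ℝ) = n := by linarith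
    exact hj.ne (by exact_mod_cast this)
  · rw [poch_eq_prod, prod_ne_zero_iff]
    intro j hj h
    rw [mem_range] at hj
    -- Since j < n, the natural number n - 1 is a true difference.
    apply hw (n - 1 + 2 * p + j)
    push_cast [Nat.cast_sub (show 1 ≤ n by omega)]
    linarith

open scoped MonomialOrder in
-- Lexicographically the right neighbour of a variable is smaller than it; to the right of the last
-- variable stands the constant M(M + ζ_{N+1}).
theorem degree_quadPoly_lt (N : ℕ) (ζ : ℕ → ℝ) (M : ℝ) (a : Fin N) :
    MonomialOrder.lex.degree (quadPoly N ζ M (a + 1 + 1)) ≺[MonomialOrder.lex]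
      Finsupp.single a 1 := by
  rw [quadPoly]
  split_ifs with h
  · rw [MonomialOrder.degree_X, MonomialOrder.lex_lt_iff, Finsupp.Lex.single_lt_iff]
    exact Fin.lt_def.mpr (by simp)
  · rw [MonomialOrder.degree_C, map_zero, MonomialOrder.toSyn_lt_iff_ne_zero]
    simp

theorem degree_racahFactor (N : ℕ) (ζ : ℕ → ℝ) (M : ℝ) (n : Fin N → ℕ) (a : Fin N)
    (hw : ∀ m : ℕ, ζ (a + 1 + 1) - ζ 0 ≠ -(m : ℝ)) :
    racahFactor N ζ M n (a + 1) ≠ 0 ∧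
      MonomialOrder.lex.degree (racahFactor N ζ M n (a + 1)) = Finsupp.single a (n a) := by
  have hq : quadPoly N ζ M (a + 1) = MvPolynomial.X a := by
    rw [quadPoly, dif_pos ⟨by omega, by omega⟩]
    rfl
  have hi : idx n (a + 1) = n a := by
    rw [idx, dif_pos ⟨by omega, by omega⟩]
    rfl
  rw [racahFactor, hq, hi]
  exact MonomialOrder.lex.degree_sum_newton a (degree_quadPoly_lt N ζ M a) (n a) _ _
    (fun i j => _) (racahCoeff_ne_zero _ hw)

theorem prod_Icc_eq_prod_fin {R : Type*} [CommMonoid R] (N : ℕ) (f : ℕ → R) :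
    ∏ k ∈ Icc 1 N, f k = ∏ a : Fin N, f (a + 1) := by
  rw [← prod_range fun k => f (k + 1)]
  induction N with
  | zero => simp
  | succ N ih => rw [prod_Icc_succ_top (by omega), ih, prod_range_succ]

/-- The polynomial representing the normalized multivariable Racah polynomial. -/
noncomputable def racahPoly (N : ℕ) (ζ : ℕ → ℝ) (M : ℝ) (n : Fin N → ℕ) :
    MvPolynomial (Fin N) ℝ :=
  MvPolynomial.C (racahNorm N ζ M n)⁻¹ * ∏ a : Fin N, racahFactor N ζ M n (a + 1)

theorem aeval_racahPoly (N : ℕ) (ζ : ℕ → ℝ) (M : ℝ) (n : Fin N → ℕ) :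
    MvPolynomial.aeval (quadVar N ζ) (racahPoly N ζ M n) = racahHat N ζ M n := by
  rw [racahPoly, racahHat, racahR, map_mul, MvPolynomial.aeval_C, map_inv₀, div_eq_inv_mul,
    ← prod_Icc_eq_prod_fin N (fun k => racahFactor N ζ M n k), map_prod]
  congr 1
  refine prod_congr rfl fun k hk => ?_
  rw [mem_Icc] at hk
  exact aeval_racahFactor N ζ M n hk.1 hk.2

theorem racahNorm_ne_zero {N : ℕ} {ζ : ℕ → ℝ} {M : ℝ} (hM : ∀ m : ℕ, M ≠ m)
    (hM0 : ∀ m : ℕ, M + ζ 0 ≠ m)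
    (hζ : ∀ k ∈ Icc 1 N, ∀ m : ℕ, ζ (k + 1) - ζ k ≠ -(m : ℝ)) (n : Fin N → ℕ) :
    racahNorm N ζ M n ≠ 0 := by
  refine mul_ne_zero (mul_ne_zero (poch_ne_zero (fun m h => hM m (neg_injective h)) _)
    (poch_ne_zero (fun m h => hM0 m ?_) _))
    (prod_ne_zero_iff.mpr fun k hk => poch_ne_zero (hζ k hk) _)
  linarith

theorem degree_racahPoly {N : ℕ} {ζ : ℕ → ℝ} {M : ℝ} (n : Fin N → ℕ)
    (hn : racahNorm N ζ M n ≠ 0)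
    (hζ0 : ∀ k ∈ Icc 1 N, ∀ m : ℕ, ζ (k + 1) - ζ 0 ≠ -(m : ℝ)) :
    racahPoly N ζ M n ≠ 0 ∧
      MonomialOrder.lex.degree (racahPoly N ζ M n) = Finsupp.equivFunOnFinite.symm n := by
  have h (a : Fin N) := degree_racahFactor N ζ M n a
    (hζ0 (a + 1) (mem_Icc.mpr ⟨by omega, by omega⟩))
  have h1 : MvPolynomial.C (σ := Fin N) (racahNorm N ζ M n)⁻¹ ≠ 0 := by simpa using hn
  have h2 : ∏ a : Fin N, racahFactor N ζ M n (a + 1) ≠ 0 :=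
    prod_ne_zero_iff.mpr fun a _ => (h a).1
  refine ⟨mul_ne_zero h1 h2, ?_⟩
  rw [racahPoly, MonomialOrder.degree_mul h1 h2, MonomialOrder.degree_C, zero_add,
    MonomialOrder.degree_prod fun a _ => (h a).1, sum_congr rfl fun a _ => (h a).2]
  ext a
  simp [Finsupp.single_apply]

/-- The basis is constructed in the polynomial ring and transported by the isomorphism that
algebraic independence of the generators provides. -/
theorem exists_basis_racahHat (N : ℕ) (ζ : ℕ → ℝ) (M : ℝ) (hM : ∀ m : ℕ, M ≠ m)
    (hM0 : ∀ m : ℕ, M + ζ 0 ≠ m)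
    (hζ : ∀ k ∈ Icc 1 N, ∀ m : ℕ, ζ (k + 1) - ζ k ≠ -(m : ℝ))
    (hζ0 : ∀ k ∈ Icc 1 N, ∀ m : ℕ, ζ (k + 1) - ζ 0 ≠ -(m : ℝ)) :
    ∃ b : Module.Basis (Fin N → ℕ) ℝ (polySpace N ζ),
      ∀ n : Fin N → ℕ, (b n : RatField N) = racahHat N ζ M n := by
  have hdeg (d : Fin N →₀ ℕ) := degree_racahPoly d (racahNorm_ne_zero hM hM0 hζ d) hζ0
  have h0 (d : Fin N →₀ ℕ) := (hdeg d).1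
  have hd (d : Fin N →₀ ℕ) : MonomialOrder.lex.degree (racahPoly N ζ M d) = d :=
    (hdeg d).2.trans (Equiv.symm_apply_apply _ d)
  let e : MvPolynomial (Fin N) ℝ ≃ₐ[ℝ] polySpace N ζ :=
    (algebraicIndependent_quadVar N ζ).aevalEquiv
  let b := Module.Basis.mk (MonomialOrder.lex.linearIndependent_of_degree h0 hd)
    (MonomialOrder.lex.span_eq_top_of_degree h0 hd).ge
  refine ⟨(b.map e.toLinearEquiv).reindex Finsupp.equivFunOnFinite, fun n => ?_⟩
  rw [Module.Basis.reindex_apply, Module.Basis.map_apply, Module.Basis.mk_apply]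
  exact ((algebraicIndependent_quadVar N ζ).algebraMap_aevalEquiv _).trans
    (aeval_racahPoly N ζ M n)

end RacahTD

theorem mainTheorem9 (N : ℕ) (ζ : ℕ → ℝ) (M : ℝ) (l : ℕ) (hl : 1 ≤ l) (hlN : l ≤ N) :
    -- the homomorphism into the algebra of difference operators
    (∃ φ : RacahTD.RacahTDAlg N ζ l →ₐ[ℝ] RacahTD.diffOps N,
      (φ (RacahTD.racahA N ζ l) : Module.End ℝ (RacahTD.RatField N)) =
        LinearMap.mulLeft ℝ (RacahTD.lamX N ζ M l) ∧
      (φ (RacahTD.racahAstar N ζ l) : Module.End ℝ (RacahTD.RatField N)) =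
        RacahTD.racahOp N ζ M l) ∧
    -- the module structure on the space of polynomials
    (∃ ψ : RacahTD.RacahTDAlg N ζ l →ₐ[ℝ] Module.End ℝ (RacahTD.polySpace N ζ),
      ∀ v : RacahTD.polySpace N ζ,
        (ψ (RacahTD.racahA N ζ l) v : RacahTD.RatField N) =
          RacahTD.lamX N ζ M l * (v : RacahTD.RatField N) ∧
        (ψ (RacahTD.racahAstar N ζ l) v : RacahTD.RatField N) =
          RacahTD.racahOp N ζ M l (v : RacahTD.RatField N)) ∧
    -- the Racah polynomials are a basis of it
    ((∀ m : ℕ, M ≠ m) → (∀ m : ℕ, M + ζ 0 ≠ m) →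
      (∀ k ∈ Finset.Icc 1 N, ∀ m : ℕ, ζ (k + 1) - ζ k ≠ -(m : ℝ)) →
      (∀ k ∈ Finset.Icc 1 N, ∀ m : ℕ, ζ (k + 1) - ζ 0 ≠ -(m : ℝ)) →
      ∃ b : Module.Basis (Fin N → ℕ) ℝ (RacahTD.polySpace N ζ),
        ∀ n : Fin N → ℕ, (b n : RacahTD.RatField N) = RacahTD.racahHat N ζ M n) :=
  ⟨RacahTD.exists_hom_diffOps N ζ M l hl hlN, RacahTD.exists_hom_polySpace N ζ M l hl hlN,
    RacahTD.exists_basis_racahHat N ζ M⟩
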